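/- Let $\mathbf k$ be a field, $G$ a finite abelian group, $g_1,\dots,g_n\in G$, and $\chi_1,\dots,\chi_n\colon G\to\mathbf k^*$ characters with $\chi_i(g_i)\ne 1$ for all $i$ and $\chi_i(g_j)\chi_j(g_i)=1$ for $i\neq j$. Put $q_{ij}=\chi_j(g_i)$ and $m_i=\operatorname{ord}(q_{ii})$. Let $\lambda_i\in\mathbf k$ and $\lambda_{ij}\in\mathbf k$ ($i\ne j$) be such that $\lambda_i(\chi_i^{m_i}-1)=0$, $\lambda_{ij}(\chi_i\chi_j-1)=0$ and $\lambda_{ij}+q_{ij}\lambda_{ji}=0$ for $i\neq j$. Let $H=H(\mathbf g,\chi,\lambda)$ be the $\mathbf k$-algebra generated by the group $G$ and $x_1,\dots,x_n$, subject to the relations of $G$ and $$gx_i=\chi_i(g)x_ig,\qquad x_ix_j=q_{ij}x_jx_i+\lambda_{ij}(1-g_ig_j)\ (i\ne j),\qquad x_i^{m_i}=\lambda_i(1-g_i^{m_i}),$$ with the Hopf algebra structure given by $\Delta(g)=g\otimes g$, $\Delta(x_i)=g_i\otimes x_i+x_i\otimes 1$, $\varepsilon(g)=1$, $\varepsilon(x_i)=0$,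 $\mathcal S(g)=g^{-1}$, $\mathcal S(x_i)=-g_i^{-1}x_i$. Then there exist a nonzero right integral $\varphi\in H^*$ (that is, $\varphi(h_{(1)})f(h_{(2)})=f(1)\varphi(h)$ for all $f\in H^*$, $h\in H$), an algebra automorphism $\rho$ of $H$ with $\varphi(ba)=\varphi(\rho(a)b)$ for all $a,b\in H$ (the Nakayama automorphism), a nonzero right integral $t\in H$ (that is, $ta=\varepsilon(a)t$ for all $a\in H$) and an algebra map $\alpha\colon H\to\mathbf k$ with $at=\alpha(a)t$ for all $a\in H$ (the modular element). For every such choice of $\varphi,\rho,t,\alpha$, put $$L_1=\langle q_{11},\dots,q_{nn},\alpha(G)\rangle\ \supseteq\ L_2=\alpha(G)$$ (subgroups of $\mathbf k^*$) and $H_\omega=\{h\in H:\rho(h)=\omega h\}$ for $\omega\in L_1$. Then $H=\bigoplus_{\omega\in L_1}H_\omega$, and the following are equivalent: 1. the decomposition $H=\bigoplus_{\omega\in L_1}H_\omega$ is strongly graded, i.e. $H_\omega H_{\omega'}=H_{\omega\omega'}$ for all $\omega,\omega'\in L_1$; 2. each component $H_\omega$, $\omega\in L_1$, contains an element of $G$;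 3. $L_1=L_2$; 4. $H$ is a crossed product $H_1\ltimes\mathbf k L_1$, i.e. there are a weak action of $L_1$ on the algebra $H_1$ by algebra endomorphisms $b\mapsto\omega\cdot b$ (with $1\cdot b=b$), a normalized map $\sigma\colon L_1\times L_1\to H_1^\times$ with $(\omega\cdot(\omega'\cdot b))\,\sigma(\omega,\omega')=\sigma(\omega,\omega')\,(\omega\omega'\cdot b)$ and $(\omega\cdot\sigma(\omega',\omega''))\,\sigma(\omega,\omega'\omega'')=\sigma(\omega,\omega')\,\sigma(\omega\omega',\omega'')$, and an algebra isomorphism onto $H$ from $H_1\otimes\mathbf kL_1$ with product $(b\otimes\omega)(b'\otimes\omega')=b(\omega\cdot b')\sigma(\omega,\omega')\otimes\omega\omega'$, which is the inclusion on $H_1$ and maps $H_1\otimes\omega$ into $H_\omega$ for all $\omega\in L_1$. -/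

import Mathlib

open scoped TensorProduct

noncomputable section

namespace QLS

universe u v w

/-! ### Gaussian binomial coefficients (needed for the comultiplication to respect `x_i ^ m_i`) -/

/-- Gaussian binomial coefficients evaluated at `q`. -/
def gaussCoeff {k : Type u} [Field k] (q : k) : ℕ → ℕ → k
  | _, 0 => 1
  | 0, _ + 1 => 0
  | m + 1, j + 1 => gaussCoeff q m j + q ^ (j + 1) * gaussCoeff q m (j + 1)

theorem gaussCoeff_zero_right {k : Type u} [Field k] (q : k) (m : ℕ) :
    gaussCoeff q m 0 = 1 := by
  cases m <;> simp [gaussCoeff]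

theorem gaussCoeff_of_lt {k : Type u} [Field k] (q : k) (m : ℕ) :
    ∀ j, m < j → gaussCoeff q m j = 0 := by
  induction m with
  | zero => intro j hj; cases j with
    | zero => omega
    | succ j => simp [gaussCoeff]
  | succ m ih => intro j hj; cases j with
    | zero => omega
    | succ j => simp [gaussCoeff, ih j (by omega), ih (j + 1) (by omega)]

theorem gaussCoeff_self {k : Type u} [Field k] (q : k) (m : ℕ) : gaussCoeff q m m = 1 := by
  induction m with
  | zero => simp [gaussCoeff]
  | succ m ih => simp [gaussCoeff, ih, gaussCoeff_of_lt q m (m + 1) (by omega)]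

theorem gaussCoeff_aux {k : Type u} [Field k] (q : k) (m : ℕ) : ∀ j,
    (q ^ (j + 1) - 1) * gaussCoeff q (m + 1) (j + 1) = (q ^ (m + 1) - 1) * gaussCoeff q m j ∧
    (q ^ (m + 1) - q ^ j) * gaussCoeff q (m + 1) j
      = q ^ j * (q ^ (m + 1) - 1) * gaussCoeff q m j := by
  induction m with
  | zero =>
    intro j
    rcases j with _ | _ | j <;> simp [gaussCoeff]
  | succ m ih =>
    intro j
    constructor
    · have h1 := (ih j).1
      have h2 := (ih j).2
      rw [show gaussCoeff q (m + 1 + 1) (j + 1) = gaussCoeff q (m + 1) j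
        + q ^ (j + 1) * gaussCoeff q (m + 1) (j + 1) from rfl]
      linear_combination q ^ (j + 1) * h1 - q * h2
    · cases j with
      | zero => simp [gaussCoeff_zero_right]
      | succ j =>
        have h1 := (ih j).1
        have h2 := (ih j).2
        rw [show gaussCoeff q (m + 1 + 1) (j + 1) = gaussCoeff q (m + 1) j
          + q ^ (j + 1) * gaussCoeff q (m + 1) (j + 1) from rfl]
        linear_combination q * h2 - q ^ (j + 1) * h1

theorem gaussCoeff_eq_zero {k : Type u} [Field k] {q : k} {m : ℕ} (hq : IsPrimitiveRoot q m)
    {j : ℕ} (h0 : 0 < j) (hj : j < m) : gaussCoeff q m j = 0 := by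
  obtain ⟨m, rfl⟩ : ∃ l, m = l + 1 := ⟨m - 1, by omega⟩
  obtain ⟨j, rfl⟩ : ∃ l, j = l + 1 := ⟨j - 1, by omega⟩
  have h := (gaussCoeff_aux q m j).1
  rw [hq.pow_eq_one, sub_self, zero_mul] at h
  have hne : q ^ (j + 1) - 1 ≠ 0 := sub_ne_zero.mpr (hq.pow_ne_one_of_pos_of_lt (by omega) hj)
  exact (mul_eq_zero.mp h).resolve_left hne

section
variable {k : Type u} [Field k] {R : Type v} [Ring R] [Algebra k R]

theorem qcomm_pow {q : k} {a b : R} (h : b * a = q • (a * b)) (j : ℕ) :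
    b * a ^ j = q ^ j • (a ^ j * b) := by
  induction j with
  | zero => simp
  | succ j ih =>
    rw [pow_succ, ← mul_assoc, ih, smul_mul_assoc, mul_assoc, h, mul_smul_comm, smul_smul,
      ← mul_assoc, pow_succ]

theorem qbinomial {q : k} {a b : R} (h : b * a = q • (a * b)) (m : ℕ) :
    (a + b) ^ m = ∑ j ∈ Finset.range (m + 1), gaussCoeff q m j • (a ^ j * b ^ (m - j)) := by
  induction m with
  | zero => simp [gaussCoeff]
  | succ m ih =>
    rw [pow_succ', ih, add_mul, Finset.mul_sum, Finset.mul_sum]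
    rw [Finset.sum_range_succ' _ (m + 1)]
    have e1 : ∀ j ∈ Finset.range (m + 1),
        a * gaussCoeff q m j • (a ^ j * b ^ (m - j))
          = gaussCoeff q m j • (a ^ (j + 1) * b ^ (m + 1 - (j + 1))) := by
      intro j _
      rw [mul_smul_comm, ← mul_assoc, ← pow_succ', Nat.add_sub_add_right]
    have e2 : ∀ j ∈ Finset.range (m + 1),
        b * gaussCoeff q m j • (a ^ j * b ^ (m - j))
          = (q ^ j * gaussCoeff q m j) • (a ^ j * b ^ (m + 1 - j)) := by
      intro j hj
      have hj' : j ≤ m := by simpa [Nat.lt_succ_iff] using hj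
      rw [mul_smul_comm, ← mul_assoc, qcomm_pow h, smul_mul_assoc, smul_smul, mul_assoc,
        ← pow_succ', Nat.sub_add_comm hj', mul_comm]
    rw [Finset.sum_congr rfl e1, Finset.sum_congr rfl e2]
    have e3 : ∑ j ∈ Finset.range (m + 1), (q ^ j * gaussCoeff q m j) • (a ^ j * b ^ (m + 1 - j))
        = ∑ j ∈ Finset.range (m + 1), (q ^ (j + 1) * gaussCoeff q m (j + 1)) •
            (a ^ (j + 1) * b ^ (m + 1 - (j + 1))) + b ^ (m + 1) := by
      rw [Finset.sum_range_succ' _ m, Finset.sum_range_succ _ m,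
        gaussCoeff_of_lt q m (m + 1) (by omega)]
      simp [gaussCoeff_zero_right]
    rw [e3, ← add_assoc, ← Finset.sum_add_distrib]
    simp [gaussCoeff, add_smul]

theorem add_pow_of_qcomm {q : k} {a b : R} {m : ℕ} (hq : IsPrimitiveRoot q m) (hm : 0 < m)
    (h : b * a = q • (a * b)) : (a + b) ^ m = a ^ m + b ^ m := by
  obtain ⟨m, rfl⟩ : ∃ l, m = l + 1 := ⟨m - 1, by omega⟩
  rw [qbinomial h, Finset.sum_range_succ, Finset.sum_range_succ', Finset.sum_eq_zero]
  · simp [gaussCoeff_self, gaussCoeff_zero_right, add_comm]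
  · intro j hj
    rw [gaussCoeff_eq_zero hq (by omega) (by simpa using hj), zero_smul]

/-- If `b a = q a b` with `q` a primitive `m`-th root of unity then `(-(a b)) ^ m = - a ^ m b ^ m`. -/
theorem neg_mul_pow_of_qcomm {q : k} {a b : R} {m : ℕ} (hq : IsPrimitiveRoot q m) (hm : 0 < m)
    (h : b * a = q • (a * b)) : (-(a * b)) ^ m = -(a ^ m * b ^ m) := by
  have key : ∀ l : ℕ, (-(a * b)) ^ l
      = ((-1) ^ l * q ^ (∑ i ∈ Finset.range l, i) : k) • (a ^ l * b ^ l) := by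
    intro l
    induction l with
    | zero => simp
    | succ l ih =>
      have hb : ∀ j : ℕ, b ^ j * a = q ^ j • (a * b ^ j) := by
        intro j
        induction j with
        | zero => simp
        | succ j ihj =>
          rw [pow_succ, mul_assoc, h, mul_smul_comm, ← mul_assoc, ihj, smul_mul_assoc, smul_smul,
            mul_assoc, pow_succ, mul_comm q]
      rw [pow_succ, ih, Finset.sum_range_succ, smul_mul_assoc, mul_neg, mul_assoc, ← mul_assoc (b ^ l),
        hb, smul_mul_assoc, mul_smul_comm, mul_assoc a, ← mul_assoc (a ^ l), ← pow_succ, ← pow_succ,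
        ← smul_neg, smul_smul, smul_neg, ← neg_smul]
      congr 1
      ring
  rw [key, ← neg_one_smul k (a ^ m * b ^ m)]
  congr 1
  rw [Finset.sum_range_id]
  rcases Nat.even_or_odd m with ⟨l, rfl⟩ | ⟨l, rfl⟩
  · have hl : 0 < l := by omega
    have h1 : q ^ l = -1 := by
      have h2 : q ^ l * q ^ l = 1 := by rw [← pow_add]; exact hq.pow_eq_one
      rcases mul_self_eq_one_iff.mp h2 with h3 | h3
      · exact absurd h3 (hq.pow_ne_one_of_pos_of_lt (by omega) (by omega))
      · exact h3
    have h2 : (l + l) * (l + l - 1) / 2 = l * (2 * (l - 1) + 1) := by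
      obtain ⟨l, rfl⟩ : ∃ r, l = r + 1 := ⟨l - 1, by omega⟩
      apply Nat.div_eq_of_eq_mul_left (by norm_num)
      rw [show l + 1 + (l + 1) - 1 = 2 * l + 1 by omega, show l + 1 - 1 = l by omega]
      ring
    rw [h2, pow_mul, h1, pow_succ, pow_mul, ← two_mul, pow_mul]
    simp
  · have h2 : (2 * l + 1) * (2 * l + 1 - 1) / 2 = (2 * l + 1) * l := by
      apply Nat.div_eq_of_eq_mul_left (by norm_num)
      rw [show 2 * l + 1 - 1 = 2 * l by omega]
      ring
    rw [h2, pow_mul, hq.pow_eq_one, one_pow, pow_succ, pow_mul]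
    simp

end

/-! ### The data and the algebra -/

/-- The data `(g, χ, λ)` of a lifting of a quantum linear space over `G`. The numbers `lam i` are the
`λ_i`, and `lamm i j` the `λ_{ij}`; the diagonal values `lamm i i` are never used. -/
structure Datum (k : Type u) [Field k] (G : Type v) [CommGroup G] (n : ℕ) where
  g : Fin n → G
  χ : Fin n → (G →* kˣ)
  lam : Fin n → k
  lamm : Fin n → Fin n → k
  χ_self_ne_one : ∀ i, χ i (g i) ≠ 1
  χ_mul_χ : ∀ i j, i ≠ j → χ i (g j) * χ j (g i) = 1
  lam_cond : ∀ i (a : G), lam i * ((χ i a : k) ^ orderOf (χ i (g i)) - 1) = 0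
  lamm_cond : ∀ i j, i ≠ j → ∀ a : G, lamm i j * ((χ i a : k) * (χ j a : k) - 1) = 0
  lamm_symm : ∀ i j, i ≠ j → lamm i j + (χ j (g i) : k) * lamm j i = 0

namespace Datum

variable {k : Type u} [Field k] {G : Type v} [CommGroup G] {n : ℕ} (D : Datum k G n)

/-- `q_{ij} = χ_j(g_i)`. -/
def q (i j : Fin n) : kˣ := D.χ j (D.g i)

/-- `m_i`, the order of `q_{ii}`. -/
def m (i : Fin n) : ℕ := orderOf (D.q i i)

/-- The generator of the free algebra attached to a group element. -/
abbrev gen (k : Type u) [Field k] {G : Type v} {n : ℕ} (a : G) : FreeAlgebra k (G ⊕ Fin n) :=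
  FreeAlgebra.ι k (Sum.inl a)

/-- The generator `x_i` of the free algebra. -/
abbrev genX (k : Type u) [Field k] (G : Type v) {n : ℕ} (i : Fin n) : FreeAlgebra k (G ⊕ Fin n) :=
  FreeAlgebra.ι k (Sum.inr i)

/-- The defining relations: those of the group `G`, and
`g x_i = χ_i(g) x_i g`, `x_i x_j = q_{ij} x_j x_i + λ_{ij} (1 - g_i g_j)` for `i ≠ j`,
`x_i ^ m_i = λ_i (1 - g_i ^ m_i)`. -/
inductive Rel : FreeAlgebra k (G ⊕ Fin n) → FreeAlgebra k (G ⊕ Fin n) → Prop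
  | one : Rel (gen k 1) 1
  | mul (a b : G) : Rel (gen k (a * b)) (gen k a * gen k b)
  | comm (a : G) (i : Fin n) : Rel (gen k a * genX k G i) ((D.χ i a : k) • (genX k G i * gen k a))
  | link (i j : Fin n) (h : i ≠ j) : Rel (genX k G i * genX k G j)
      ((D.q i j : k) • (genX k G j * genX k G i) + D.lamm i j • (1 - gen k (D.g i * D.g j)))
  | pow (i : Fin n) : Rel (genX k G i ^ D.m i) (D.lam i • (1 - gen k (D.g i ^ D.m i)))

/-- The lifting `H(g, χ, λ)` as an algebra. -/
def H : Type (max u v) := RingQuot D.Rel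

instance : Ring D.H := inferInstanceAs (Ring (RingQuot D.Rel))
instance : Algebra k D.H := inferInstanceAs (Algebra k (RingQuot D.Rel))

/-- The quotient map from the free algebra. -/
def quot : FreeAlgebra k (G ⊕ Fin n) →ₐ[k] D.H := RingQuot.mkAlgHom k D.Rel

theorem quot_surjective : Function.Surjective D.quot := RingQuot.mkAlgHom_surjective k D.Rel

theorem quot_rel {a b : FreeAlgebra k (G ⊕ Fin n)} (h : D.Rel a b) : D.quot a = D.quot b :=
  RingQuot.mkAlgHom_rel k h

/-- The group elements in `H`. -/
def of : G →* D.H where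
  toFun a := D.quot (gen k a)
  map_one' := by rw [D.quot_rel .one, map_one]
  map_mul' a b := by rw [D.quot_rel (.mul a b), map_mul]

/-- The generators `x_i` of `H`. -/
def x (i : Fin n) : D.H := D.quot (genX k G i)

theorem of_mul_x (a : G) (i : Fin n) : D.of a * D.x i = (D.χ i a : k) • (D.x i * D.of a) := by
  have := D.quot_rel (.comm a i)
  simp only [map_mul, map_smul] at this
  exact this

theorem x_mul_x (i j : Fin n) (h : i ≠ j) : D.x i * D.x j
    = (D.q i j : k) • (D.x j * D.x i) + D.lamm i j • (1 - D.of (D.g i * D.g j)) := by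
  have := D.quot_rel (.link i j h)
  simp only [map_mul, map_smul, map_add, map_sub, map_one] at this
  exact this

theorem x_pow (i : Fin n) : D.x i ^ D.m i = D.lam i • (1 - D.of (D.g i ^ D.m i)) := by
  have := D.quot_rel (.pow i)
  simp only [map_pow, map_smul, map_sub, map_one] at this
  exact this

theorem induction {P : D.H → Prop} (halg : ∀ c : k, P (algebraMap k D.H c))
    (hof : ∀ a, P (D.of a)) (hx : ∀ i, P (D.x i)) (hmul : ∀ a b, P a → P b → P (a * b))
    (hadd : ∀ a b, P a → P b → P (a + b)) (h : D.H) : P h := by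
  obtain ⟨y, rfl⟩ := D.quot_surjective h
  induction y using FreeAlgebra.induction with
  | grade0 r => rw [AlgHom.commutes]; exact halg r
  | grade1 z => rcases z with a | i; exacts [hof a, hx i]
  | mul a b ha hb => rw [map_mul]; exact hmul _ _ ha hb
  | add a b ha hb => rw [map_add]; exact hadd _ _ ha hb

theorem algHom_ext {B : Type w} [Semiring B] [Algebra k B] {e f : D.H →ₐ[k] B}
    (hof : ∀ a, e (D.of a) = f (D.of a)) (hx : ∀ i, e (D.x i) = f (D.x i)) : e = f := by
  ext h
  induction h using D.induction with
  | halg c => simp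
  | hof a => exact hof a
  | hx i => exact hx i
  | hmul a b ha hb => rw [map_mul, map_mul, ha, hb]
  | hadd a b ha hb => rw [map_add, map_add, ha, hb]

/-- The universal property of the presentation. -/
def lift {B : Type w} [Ring B] [Algebra k B] (e : G →* B) (y : Fin n → B)
    (h1 : ∀ a i, e a * y i = (D.χ i a : k) • (y i * e a))
    (h2 : ∀ i j, i ≠ j → y i * y j
      = (D.q i j : k) • (y j * y i) + D.lamm i j • (1 - e (D.g i * D.g j)))
    (h3 : ∀ i, y i ^ D.m i = D.lam i • (1 - e (D.g i ^ D.m i))) : D.H →ₐ[k] B :=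
  RingQuot.liftAlgHom k ⟨FreeAlgebra.lift k (Sum.elim e y), by
    intro a b h
    induction h with
    | one => simp [gen]
    | mul a b => simp [gen]
    | comm a i => simpa [gen, genX] using h1 a i
    | link i j h => simpa [gen, genX] using h2 i j h
    | pow i => simpa [gen, genX] using h3 i⟩

section
variable {B : Type w} [Ring B] [Algebra k B] (e : G →* B) (y : Fin n → B)
    (h1 : ∀ a i, e a * y i = (D.χ i a : k) • (y i * e a))
    (h2 : ∀ i j, i ≠ j → y i * y j
      = (D.q i j : k) • (y j * y i) + D.lamm i j • (1 - e (D.g i * D.g j)))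
    (h3 : ∀ i, y i ^ D.m i = D.lam i • (1 - e (D.g i ^ D.m i)))

@[simp] theorem lift_of (a : G) : D.lift e y h1 h2 h3 (D.of a) = e a := by
  change RingQuot.liftAlgHom k _ (RingQuot.mkAlgHom k D.Rel _) = _
  rw [RingQuot.liftAlgHom_mkAlgHom_apply]
  simp [gen]

@[simp] theorem lift_x (i : Fin n) : D.lift e y h1 h2 h3 (D.x i) = y i := by
  change RingQuot.liftAlgHom k _ (RingQuot.mkAlgHom k D.Rel _) = _
  rw [RingQuot.liftAlgHom_mkAlgHom_apply]
  simp [genX]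

end

/-! ### The Hopf algebra structure -/

theorem isPrimitiveRoot_q (i : Fin n) : IsPrimitiveRoot (D.q i i : k) (D.m i) :=
  IsPrimitiveRoot.coe_units_iff.mpr (IsPrimitiveRoot.orderOf _)

theorem q_mul_q (i j : Fin n) (h : i ≠ j) : (D.q i j : k) * (D.q j i : k) = 1 := by
  rw [← Units.val_mul, q, q, D.χ_mul_χ j i h.symm, Units.val_one]

theorem x_mul_of (a : G) (i : Fin n) : (D.χ i a : k) • (D.x i * D.of a) = D.of a * D.x i :=
  (D.of_mul_x a i).symm

theorem x_mul_of_inv (a : G) (i : Fin n) :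
    D.x i * D.of a⁻¹ = (D.χ i a : k) • (D.of a⁻¹ * D.x i) := by
  rw [D.of_mul_x, smul_smul, ← Units.val_mul, ← map_mul, mul_inv_cancel, map_one, Units.val_one, one_smul]

variable [Finite G]

theorem m_pos (i : Fin n) : 0 < D.m i := by
  rw [m, orderOf_pos_iff]
  exact MonoidHom.isOfFinOrder (D.χ i) (isOfFinOrder_of_finite (D.g i))

/-- The counit: `ε(g) = 1`, `ε(x_i) = 0`. -/
def counitHom : D.H →ₐ[k] k :=
  D.lift 1 0 (by simp) (by simp) (by intro i; simp [(D.m_pos i).ne'])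

/-- The comultiplication: `Δ(g) = g ⊗ g`, `Δ(x_i) = g_i ⊗ x_i + x_i ⊗ 1`. -/
def comulHom : D.H →ₐ[k] D.H ⊗[k] D.H :=
  D.lift
    { toFun := fun a => D.of a ⊗ₜ D.of a
      map_one' := by rw [map_one]; rfl
      map_mul' := fun a b => by rw [map_mul, Algebra.TensorProduct.tmul_mul_tmul] }
    (fun i => D.of (D.g i) ⊗ₜ D.x i + D.x i ⊗ₜ 1)
    (by
      intro a i
      simp only [MonoidHom.coe_mk, OneHom.coe_mk, mul_add, add_mul,
        Algebra.TensorProduct.tmul_mul_tmul, D.of_mul_x, mul_one, one_mul, smul_add,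
        TensorProduct.tmul_smul, TensorProduct.smul_tmul']
      rw [← map_mul, ← map_mul, mul_comm])
    (by
      intro i j h
      have e1 : D.of (D.g i) * D.x j = (D.q i j : k) • (D.x j * D.of (D.g i)) := D.of_mul_x _ _
      have e2 : D.of (D.g j) * D.x i = (D.q j i : k) • (D.x i * D.of (D.g j)) := D.of_mul_x _ _
      have e3 : D.of (D.g j) * D.of (D.g i) = D.of (D.g i * D.g j) := by
        rw [← map_mul, mul_comm]
      simp only [MonoidHom.coe_mk, OneHom.coe_mk, mul_add, add_mul,
        Algebra.TensorProduct.tmul_mul_tmul, mul_one, one_mul]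
      rw [e1, e2, e3, D.x_mul_x i j h, ← map_mul]
      simp only [TensorProduct.tmul_add, TensorProduct.add_tmul, TensorProduct.tmul_smul,
        ← TensorProduct.smul_tmul', TensorProduct.tmul_sub, TensorProduct.sub_tmul, smul_add,
        smul_sub, smul_smul, D.q_mul_q i j h, one_smul, Algebra.TensorProduct.one_def]
      abel)
    (by
      intro i
      have hq : (D.of (D.g i) ⊗ₜ[k] D.x i) * (D.x i ⊗ₜ[k] 1)
          = (D.q i i : k) • ((D.x i ⊗ₜ[k] 1) * (D.of (D.g i) ⊗ₜ[k] D.x i)) := by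
        simp only [Algebra.TensorProduct.tmul_mul_tmul, mul_one, one_mul, D.of_mul_x,
          ← TensorProduct.smul_tmul', q]
      rw [add_comm, add_pow_of_qcomm (D.isPrimitiveRoot_q i) (D.m_pos i) hq]
      simp only [MonoidHom.coe_mk, OneHom.coe_mk, Algebra.TensorProduct.tmul_pow, one_pow, D.x_pow,
        ← map_pow, TensorProduct.tmul_smul, ← TensorProduct.smul_tmul', TensorProduct.tmul_sub,
        TensorProduct.sub_tmul, smul_sub, Algebra.TensorProduct.one_def]
      abel)

/-- The antipode, as an algebra map to the opposite algebra: `S(g) = g⁻¹`, `S(x_i) = - g_i⁻¹ x_i`. -/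
def antipodeHom : D.H →ₐ[k] D.Hᵐᵒᵖ :=
  D.lift
    { toFun := fun a => MulOpposite.op (D.of a⁻¹)
      map_one' := by simp
      map_mul' := fun a b => by rw [← MulOpposite.op_mul, ← map_mul, mul_inv, mul_comm] }
    (fun i => MulOpposite.op (-(D.of (D.g i)⁻¹ * D.x i)))
    (by
      intro a i
      simp only [MonoidHom.coe_mk, OneHom.coe_mk, ← MulOpposite.op_mul, ← MulOpposite.op_smul]
      congr 1
      rw [neg_mul, mul_neg, mul_assoc, D.x_mul_of_inv, mul_smul_comm, ← mul_assoc, ← mul_assoc,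
        ← map_mul, ← map_mul, mul_comm a⁻¹, smul_neg])
    (by
      intro i j h
      simp only [MonoidHom.coe_mk, OneHom.coe_mk, ← MulOpposite.op_mul, ← MulOpposite.op_smul,
        ← MulOpposite.op_one, ← MulOpposite.op_sub, ← MulOpposite.op_add]
      congr 1
      have key : ∀ i j, -(D.of (D.g j)⁻¹ * D.x j) * -(D.of (D.g i)⁻¹ * D.x i)
          = (D.q i j : k) • (D.of (D.g i * D.g j)⁻¹ * (D.x j * D.x i)) := by
        intro i j
        rw [neg_mul_neg, mul_assoc, ← mul_assoc (D.x j), D.x_mul_of_inv, smul_mul_assoc,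
          mul_smul_comm, ← mul_assoc, ← mul_assoc, ← map_mul, ← mul_inv, mul_comm (D.g j), mul_assoc]
        rfl
      rw [key i j, key j i, smul_smul, D.q_mul_q i j h, one_smul, D.x_mul_x i j h,
        mul_comm (D.g j), mul_add, mul_smul_comm, mul_smul_comm, mul_sub, mul_one, ← map_mul,
        inv_mul_cancel, map_one, smul_sub, smul_sub]
      abel)
    (by
      intro i
      simp only [MonoidHom.coe_mk, OneHom.coe_mk, ← MulOpposite.op_pow, ← MulOpposite.op_smul,
        ← MulOpposite.op_one, ← MulOpposite.op_sub]
      congr 1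
      rw [neg_mul_pow_of_qcomm (D.isPrimitiveRoot_q i) (D.m_pos i) (D.x_mul_of_inv _ _), D.x_pow,
        ← map_pow, mul_smul_comm, mul_sub, mul_one, ← map_mul, inv_pow, inv_mul_cancel, map_one,
        ← smul_neg, neg_sub])

@[simp] theorem counitHom_of (a : G) : D.counitHom (D.of a) = 1 := by simp [counitHom]
@[simp] theorem counitHom_x (i : Fin n) : D.counitHom (D.x i) = 0 := by simp [counitHom]
@[simp] theorem comulHom_of (a : G) : D.comulHom (D.of a) = D.of a ⊗ₜ D.of a := by
  simp [comulHom]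
@[simp] theorem comulHom_x (i : Fin n) :
    D.comulHom (D.x i) = D.of (D.g i) ⊗ₜ D.x i + D.x i ⊗ₜ 1 := by
  simp [comulHom]

/-- The antipode as a linear map. -/
def antipodeLin : D.H →ₗ[k] D.H :=
  (MulOpposite.opLinearEquiv k).symm.toLinearMap ∘ₗ D.antipodeHom.toLinearMap

@[simp] theorem antipodeLin_of (a : G) : D.antipodeLin (D.of a) = D.of a⁻¹ := by
  simp [antipodeLin, antipodeHom]
@[simp] theorem antipodeLin_x (i : Fin n) :
    D.antipodeLin (D.x i) = -(D.of (D.g i)⁻¹ * D.x i) := by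
  simp [antipodeLin, antipodeHom]
@[simp] theorem antipodeLin_one : D.antipodeLin 1 = 1 := by
  simp [antipodeLin]
theorem antipodeLin_mul (a b : D.H) :
    D.antipodeLin (a * b) = D.antipodeLin b * D.antipodeLin a := by
  simp [antipodeLin]

instance : Bialgebra k D.H :=
  Bialgebra.ofAlgHom D.comulHom D.counitHom
    (by
      apply D.algHom_ext
      · intro a; simp
      · intro i
        simp [TensorProduct.tmul_add, TensorProduct.add_tmul, Algebra.TensorProduct.one_def,
          add_assoc])
    (by apply D.algHom_ext <;> simp)
    (by apply D.algHom_ext <;> simp)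

theorem comul_eq (h : D.H) : Coalgebra.comul (R := k) h = D.comulHom h := rfl
theorem counit_eq (h : D.H) : Coalgebra.counit (R := k) h = D.counitHom h := rfl

theorem antipode_left (h : D.H) :
    LinearMap.mul' k D.H (D.antipodeLin.rTensor D.H (D.comulHom h))
      = algebraMap k D.H (D.counitHom h) := by
  induction h using D.induction with
  | halg c => simp [Algebra.TensorProduct.one_def, Algebra.algebraMap_eq_smul_one]
  | hof a => simp [← map_mul]
  | hx i => simp
  | hadd a b ha hb => simp only [map_add, ha, hb]
  | hmul a b ha hb =>
    have key : ∀ (u : D.H ⊗[k] D.H) (c d : D.H),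
        LinearMap.mul' k D.H (D.antipodeLin.rTensor D.H (u * c ⊗ₜ d))
          = D.antipodeLin c * LinearMap.mul' k D.H (D.antipodeLin.rTensor D.H u) * d := by
      intro u c d
      induction u with
      | zero => simp
      | tmul e f => simp [antipodeLin_mul, mul_assoc]
      | add u v hu hv => simp only [add_mul, mul_add, map_add, hu, hv]
    have key2 : ∀ v : D.H ⊗[k] D.H,
        LinearMap.mul' k D.H (D.antipodeLin.rTensor D.H (D.comulHom a * v))
          = D.counitHom a • LinearMap.mul' k D.H (D.antipodeLin.rTensor D.H v) := by
      intro v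
      induction v with
      | zero => simp
      | tmul e f => rw [key, ha]; simp [Algebra.algebraMap_eq_smul_one]
      | add u v hu hv => simp only [mul_add, map_add, hu, hv, smul_add]
    rw [map_mul, key2, hb, map_mul, map_mul, Algebra.smul_def]

theorem antipode_right (h : D.H) :
    LinearMap.mul' k D.H (D.antipodeLin.lTensor D.H (D.comulHom h))
      = algebraMap k D.H (D.counitHom h) := by
  induction h using D.induction with
  | halg c => simp [Algebra.TensorProduct.one_def, Algebra.algebraMap_eq_smul_one]
  | hof a => simp [← map_mul]
  | hx i => simp [← mul_assoc, ← map_mul]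
  | hadd a b ha hb => simp only [map_add, ha, hb]
  | hmul a b ha hb =>
    have key : ∀ (u : D.H ⊗[k] D.H) (c d : D.H),
        LinearMap.mul' k D.H (D.antipodeLin.lTensor D.H (c ⊗ₜ d * u))
          = c * LinearMap.mul' k D.H (D.antipodeLin.lTensor D.H u) * D.antipodeLin d := by
      intro u c d
      induction u with
      | zero => simp
      | tmul e f => simp [antipodeLin_mul, mul_assoc]
      | add u v hu hv => simp only [add_mul, mul_add, map_add, hu, hv]
    have key2 : ∀ v : D.H ⊗[k] D.H,
        LinearMap.mul' k D.H (D.antipodeLin.lTensor D.H (v * D.comulHom b))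
          = D.counitHom b • LinearMap.mul' k D.H (D.antipodeLin.lTensor D.H v) := by
      intro v
      induction v with
      | zero => simp
      | tmul e f => rw [key, hb]; simp [Algebra.algebraMap_eq_smul_one]
      | add u v hu hv => simp only [add_mul, map_add, hu, hv, smul_add]
    rw [map_mul, key2, ha, map_mul, mul_comm, map_mul, Algebra.smul_def]

instance : HopfAlgebra k D.H where
  antipode := D.antipodeLin
  mul_antipode_rTensor_comul := LinearMap.ext D.antipode_left
  mul_antipode_lTensor_comul := LinearMap.ext D.antipode_right

end Datum

/-! ### Integrals, the Nakayama automorphism and the modular element -/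

section Integrals
variable (k : Type u) [Field k] (A : Type v) [Ring A] [HopfAlgebra k A]

/-- `t` is a right integral in the Hopf algebra `A`: `t a = ε(a) t` for all `a`. -/
def IsRightIntegral (t : A) : Prop :=
  ∀ a : A, t * a = Coalgebra.counit (R := k) a • t

/-- `φ` is a right integral in the dual of `A`: for the convolution product,
`φ * f = f(1) φ` for all `f`, where `(φ * f)(h) = φ(h₁) f(h₂)`. -/
def IsDualRightIntegral (φ : Module.Dual k A) : Prop :=
  ∀ (f : Module.Dual k A) (h : A),
    LinearMap.mul' k k (TensorProduct.map φ f (Coalgebra.comul (R := k) h)) = f 1 * φ h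

/-- A choice of: a nonzero right integral `φ` in the dual of `A`, an algebra automorphism `ρ` which is
the Nakayama automorphism with respect to `φ`, i.e. `a φ = φ ρ(a)` in the bimodule `A^*`
(where `(a φ)(b) = φ(b a)` and `(φ a)(b) = φ(a b)`); a nonzero right integral `t` in `A`, and the modular
element `α`, an algebra map with `a t = α(a) t`. -/
structure NakayamaData where
  φ : Module.Dual k A
  φ_ne_zero : φ ≠ 0
  φ_integral : IsDualRightIntegral k A φ
  ρ : A ≃ₐ[k] A
  φ_mul : ∀ a b : A, φ (b * a) = φ (ρ a * b)
  t : A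
  t_ne_zero : t ≠ 0
  t_integral : IsRightIntegral k A t
  α : A →ₐ[k] k
  mul_t : ∀ a : A, a * t = α a • t

end Integrals

/-! ### Strongly graded algebras and crossed products -/

section Graded
variable (k : Type u) [Field k] {A : Type v} [Ring A] [Algebra k A] {L : Type w} [Group L]

open scoped Classical in
/-- `A` is the direct sum of the subspaces `A_l`, `l ∈ L`. -/
def IsDecomposition {L : Type w} (𝒜 : L → Submodule k A) : Prop :=
  DirectSum.IsInternal 𝒜

/-- `A` is the direct sum of the subspaces `A_l`, `l ∈ L`, and `A_l A_l' = A_{l l'}`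
(the product of subspaces is the span of the products). -/
def IsStronglyGraded (𝒜 : L → Submodule k A) : Prop :=
  IsDecomposition k 𝒜 ∧ ∀ l l' : L, 𝒜 l * 𝒜 l' = 𝒜 (l * l')

/-- The data of a crossed product of an algebra `B` with the group algebra of `L`: a weak action of `L`
on `B` and a normal invertible cocycle `σ` satisfying the twisted module condition. -/
structure CrossedSystem (B : Type v) [Ring B] [Algebra k B] (L : Type w) [Group L] where
  act : L → (B →ₐ[k] B)
  σ : L → L → Bˣ
  act_one : ∀ b, act 1 b = b
  σ_one_left : ∀ l, σ 1 l = 1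
  σ_one_right : ∀ l, σ l 1 = 1
  twisted : ∀ l l' b, act l (act l' b) * (σ l l' : B) = (σ l l' : B) * act (l * l') b
  cocycle : ∀ l l' l'', act l (σ l' l'' : B) * (σ l (l' * l'') : B)
    = (σ l l' : B) * (σ (l * l') l'' : B)

/-- The graded algebra `A = ⊕ A_l` is a crossed product of its subalgebra `B` with `k L`: it is
isomorphic to `B ⊗ k L` with the product `(b ⊗ l) (b' ⊗ l') = b (l · b') σ(l, l') ⊗ l l'`, by an isomorphism
that is the inclusion on `B` and that maps `B ⊗ l` into `A_l`. -/
def IsCrossedProduct (B : Subalgebra k A) (𝒜 : L → Submodule k A) : Prop :=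
  ∃ (C : CrossedSystem k B L) (Φ : B ⊗[k] MonoidAlgebra k L ≃ₗ[k] A),
    (∀ (b b' : B) (l l' : L),
      Φ (b ⊗ₜ MonoidAlgebra.of k L l) * Φ (b' ⊗ₜ MonoidAlgebra.of k L l')
        = Φ ((b * C.act l b' * (C.σ l l' : B)) ⊗ₜ MonoidAlgebra.of k L (l * l'))) ∧
    (∀ b : B, Φ (b ⊗ₜ 1) = b) ∧
    (∀ (b : B) (l : L), Φ (b ⊗ₜ MonoidAlgebra.of k L l) ∈ 𝒜 l)

end Graded

/-! ### The decomposition of a lifting -/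

namespace Datum

variable {k : Type u} [Field k] {G : Type v} [CommGroup G] [Finite G] {n : ℕ} (D : Datum k G n)
  (N : NakayamaData k D.H)

/-- The character of `G` obtained by restricting the modular element `α`. -/
def αG : G →* kˣ := (N.α : D.H →* k).comp D.of |>.toHomUnits

/-- `L₂ = α(G)`. -/
def L₂ : Subgroup kˣ := (D.αG N).range

/-- `L₁ = ⟨q_{11}, …, q_{nn}, α(G)⟩`. -/
def L₁ : Subgroup kˣ :=
  Subgroup.closure (Set.range (fun i => D.q i i) ∪ Set.range (D.αG N))

/-- `H_ω = {h : ρ(h) = ω h}`, for `ω ∈ L₁`. -/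
def component (ω : D.L₁ N) : Submodule k D.H :=
  Module.End.eigenspace N.ρ.toLinearMap ((ω : kˣ) : k)

/-- The component `H_1`, as a subalgebra: the elements fixed by `ρ`. -/
def componentOne : Subalgebra k D.H :=
  AlgHom.equalizer (N.ρ : D.H →ₐ[k] D.H) (AlgHom.id k D.H)

end Datum

end QLS

end

/-! The key is the value of `ρ` on generators: `ρ(g) = α(g)⁻¹ g` and `ρ(x_i) = (q_ii α(g_i))⁻¹ x_i`
(`ρ_of`, `ρ_x`). So `H` is generated by eigenvectors of `ρ` with eigenvalues in `L₁`. As `ρ` is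
multiplicative, the eigenspaces `H_ω` span `H`, and eigenspaces for distinct eigenvalues are
independent.

These formulas come from `φ(ρ(a) t₁) t₂ = φ(t) S(a)`, together with `Δ(a) Δ(t) = α(a) Δ(t)`, `α(x_i)
= 0`, `φ(t) ≠ 0` and the injectivity of `S`.

Existence needs no PBW basis. `H` is finite-dimensional, because the `x_i` can be adjoined to the
span of `G` one at a time. It is exhausted by the iterated wedges of that span, so some nonzero
functional `f` has `f(h₁) h₂` in the span of `G` for all `h`. Composing with the coordinate at a
suitable group element and translating gives a right integral `φ`. Such a `φ` is nondegenerate, and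
`ρ`, `t`, `α` are then read off from the duality `a ↦ φ(a ·)`.

For the equivalences, let `d = |L₂|`. Then `ρ^d` fixes `G`, so `ε ∘ ρ^d = ε`. In a strong grading
`ε` cannot vanish on any `H_ω`, whence `ω^d = 1`; since `L₂` already contains every `d`-th root of
unity of the field, `L₁ = L₂`. Conversely, if `L₁ = L₂`, every `H_ω` contains some group element
`s(ω)`, which is a unit, so `H_ω = H_1 s(ω)`; this is a crossed product, and a crossed product is
strongly graded. -/

noncomputable section

namespace QLS

universe u v w

/-! ### The action of the dual on a Hopf algebra -/

section Hopf
variable {k : Type u} [Field k] {A : Type v} [Ring A] [HopfAlgebra k A]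

/-- The contraction `a ⊗ b ↦ f(a) b`. -/
def contract (f : Module.Dual k A) : A ⊗[k] A →ₗ[k] A :=
  (TensorProduct.lid k A).toLinearMap ∘ₗ f.rTensor A

@[simp] theorem contract_tmul (f : Module.Dual k A) (a b : A) :
    contract f (a ⊗ₜ[k] b) = f a • b := by simp [contract]

theorem contract_mul_one_tmul (f : Module.Dual k A) (w : A ⊗[k] A) (b : A) :
    contract f (w * 1 ⊗ₜ b) = contract f w * b := by
  induction w with
  | zero => simp
  | tmul c d => simp
  | add w z hw hz => simp only [add_mul, map_add, hw, hz]

theorem contract_one_tmul_mul (f : Module.Dual k A) (w : A ⊗[k] A) (b : A) :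
    contract f (1 ⊗ₜ b * w) = b * contract f w := by
  induction w with
  | zero => simp
  | tmul c d => simp
  | add w z hw hz => simp only [mul_add, map_add, hw, hz]

theorem contract_mul_tmul_one (f : Module.Dual k A) (w : A ⊗[k] A) (b : A) :
    contract f (w * b ⊗ₜ 1) = contract (f ∘ₗ LinearMap.mulRight k b) w := by
  induction w with
  | zero => simp
  | tmul c d => simp
  | add w z hw hz => simp only [add_mul, map_add, hw, hz]

theorem contract_tmul_one_mul (f : Module.Dual k A) (w : A ⊗[k] A) (b : A) :
    contract f (b ⊗ₜ 1 * w) = contract (f ∘ₗ LinearMap.mulLeft k b) w := by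
  induction w with
  | zero => simp
  | tmul c d => simp
  | add w z hw hz => simp only [mul_add, map_add, hw, hz]

theorem contract_rTensor (f : Module.Dual k A) (e : A →ₗ[k] A) (w : A ⊗[k] A) :
    contract f (e.rTensor A w) = contract (f ∘ₗ e) w := by
  induction w with
  | zero => simp
  | tmul c d => simp
  | add w z hw hz => simp only [map_add, hw, hz]

/-- The action of the dual on `A`: `hit f h = f(h₁) h₂`. -/
def hit (f : Module.Dual k A) : A →ₗ[k] A :=
  contract f ∘ₗ Coalgebra.comul

theorem hit_apply (f : Module.Dual k A) (h : A) :
    hit f h = contract f (Coalgebra.comul (R := k) h) := rfl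

theorem counit_hit (f : Module.Dual k A) (h : A) :
    Coalgebra.counit (R := k) (hit f h) = f h := by
  have key : ∀ w : A ⊗[k] A, Coalgebra.counit (R := k) (contract f w)
      = f (TensorProduct.rid k A ((Coalgebra.counit (R := k) (A := A)).lTensor A w)) := by
    intro w
    induction w with
    | zero => simp
    | tmul c d => simp [mul_comm]
    | add w z hw hz => simp only [map_add, hw, hz]
  rw [hit_apply, key, Coalgebra.lTensor_counit_comul]
  simp

theorem hit_counit (h : A) : hit (Coalgebra.counit (R := k) (A := A)) h = h := by
  rw [hit_apply, contract, LinearMap.comp_apply, Coalgebra.rTensor_counit_comul]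
  simp

theorem comul_hit (f : Module.Dual k A) (h : A) : Coalgebra.comul (R := k) (hit f h)
    = (hit f).rTensor A (Coalgebra.comul (R := k) h) := by
  let E : A ⊗[k] (A ⊗[k] A) →ₗ[k] A ⊗[k] A :=
    (TensorProduct.lid k (A ⊗[k] A)).toLinearMap ∘ₗ f.rTensor (A ⊗[k] A)
  have h1 : ∀ w : (A ⊗[k] A) ⊗[k] A,
      E (TensorProduct.assoc k A A A w) = (contract f).rTensor A w := by
    intro w
    have : E ∘ₗ (TensorProduct.assoc k A A A).toLinearMap = (contract f).rTensor A := by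
      ext a b c
      simp [E, TensorProduct.smul_tmul']
    exact LinearMap.congr_fun this w
  have h2 : ∀ w : A ⊗[k] A, E ((Coalgebra.comul (R := k) (A := A)).lTensor A w)
      = Coalgebra.comul (R := k) (contract f w) := by
    intro w
    induction w with
    | zero => simp
    | tmul c d => simp [E]
    | add w z hw hz => simp only [map_add, hw, hz]
  rw [hit_apply, ← h2, ← Coalgebra.coassoc_apply, h1, hit, LinearMap.rTensor_comp_apply]

theorem hit_hit (f e : Module.Dual k A) (h : A) : hit e (hit f h) = hit (e ∘ₗ hit f) h := by
  rw [hit_apply e, comul_hit, contract_rTensor, hit_apply]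

/-- `φ(a₁ b) a₂ = φ(a b₁) S(b₂)` for a right integral `φ`. -/
theorem contract_comul_mul_tmul_one (φ : Module.Dual k A)
    (hφ : ∀ h, hit φ h = φ h • (1 : A)) (a b : A) :
    contract φ (Coalgebra.comul (R := k) a * b ⊗ₜ 1)
      = HopfAlgebra.antipode k (hit (φ ∘ₗ LinearMap.mulLeft k a) b) := by
  -- `Γ(c ⊗ d) = Δ(c) (1 ⊗ S(d))`, so `Γ(Δ(b)) = b₁ ⊗ b₂ S(b₃) = b ⊗ 1`. Hence `Δ(a) (b ⊗ 1) = Δ(a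
  -- b₁) (1 ⊗ S(b₂))`, and the integral property applies to `a b₁`.
  let Γ : A ⊗[k] A →ₗ[k] A ⊗[k] A :=
    (LinearMap.mul' k A ∘ₗ (HopfAlgebra.antipode k).lTensor A).lTensor A ∘ₗ
      (TensorProduct.assoc k A A A).toLinearMap ∘ₗ (Coalgebra.comul (R := k) (A := A)).rTensor A
  have h1 : ∀ c d : A, Γ (c ⊗ₜ d)
      = Coalgebra.comul (R := k) c * 1 ⊗ₜ HopfAlgebra.antipode k d := by
    intro c d
    simp only [Γ, LinearMap.comp_apply, LinearMap.rTensor_tmul]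
    induction Coalgebra.comul (R := k) c with
    | zero => simp
    | tmul p r => simp
    | add w z hw hz => simp only [map_add, TensorProduct.add_tmul, add_mul, hw, hz]
  have h2 : Γ (Coalgebra.comul (R := k) b) = b ⊗ₜ 1 := by
    simp only [Γ, LinearMap.comp_apply, LinearEquiv.coe_coe]
    rw [Coalgebra.coassoc_apply, ← LinearMap.lTensor_comp_apply, LinearMap.comp_assoc,
      HopfAlgebra.mul_antipode_lTensor_comul, LinearMap.lTensor_comp_apply,
      Coalgebra.lTensor_counit_comul]
    simp
  have h3 : ∀ w : A ⊗[k] A, contract φ (Coalgebra.comul (R := k) a * Γ w)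
      = HopfAlgebra.antipode k (contract (φ ∘ₗ LinearMap.mulLeft k a) w) := by
    intro w
    induction w with
    | zero => simp
    | tmul c d =>
      rw [h1, ← mul_assoc, contract_mul_one_tmul, ← Bialgebra.comul_mul, ← hit_apply, hφ]
      simp
    | add w z hw hz => simp only [map_add, mul_add, hw, hz]
  rw [← h2, h3, hit_apply]

theorem isDualRightIntegral_iff (φ : Module.Dual k A) :
    IsDualRightIntegral k A φ ↔ ∀ h, hit φ h = φ h • (1 : A) := by
  have key : ∀ (f : Module.Dual k A) (w : A ⊗[k] A),
      LinearMap.mul' k k (TensorProduct.map φ f w) = f (contract φ w) := by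
    intro f w
    induction w with
    | zero => simp
    | tmul c d => simp
    | add w z hw hz => simp only [map_add, hw, hz]
  constructor
  · intro h a
    rw [← sub_eq_zero, ← Module.forall_dual_apply_eq_zero_iff k]
    intro f
    have := h f a
    rw [key, ← hit_apply] at this
    rw [map_sub, this, map_smul, smul_eq_mul, mul_comm, sub_self]
  · intro h f a
    rw [key, ← hit_apply, h, map_smul, smul_eq_mul, mul_comm]

/-- A nonzero right integral in the dual is a nondegenerate functional. -/
theorem eq_zero_of_forall_mul_eq_zero [FiniteDimensional k A] (φ : Module.Dual k A) (hne : φ ≠ 0)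
    (hφ : ∀ h, hit φ h = φ h • (1 : A)) {a : A} (ha : ∀ b, φ (a * b) = 0) : a = 0 := by
  let B := Module.finBasis k A
  have hrep : ∀ a : A, ∃ c : Fin (Module.finrank k A) → A,
      Coalgebra.comul (R := k) a = ∑ i, c i ⊗ₜ[k] B i := by
    intro a
    induction Coalgebra.comul (R := k) a with
    | zero => exact ⟨0, by simp⟩
    | tmul p r =>
      refine ⟨fun i => B.repr r i • p, ?_⟩
      simp only [TensorProduct.smul_tmul, ← TensorProduct.tmul_sum, B.sum_repr]
    | add w z hw hz =>
      obtain ⟨c, hc⟩ := hw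
      obtain ⟨d, hd⟩ := hz
      exact ⟨c + d, by simp [hc, hd, TensorProduct.add_tmul, Finset.sum_add_distrib]⟩
  -- Let `J` be the set of `a` with `φ(a A) = 0`. For `a ∈ J` the identity above gives `φ(a₁ b) a₂ =
  -- 0`, and comparing coefficients in the basis shows `Δ(J) ⊆ J ⊗ A`.
  have hrepJ : ∀ a : A, (∀ b, φ (a * b) = 0) → ∃ c : Fin (Module.finrank k A) → A,
      Coalgebra.comul (R := k) a = ∑ i, c i ⊗ₜ[k] B i ∧ ∀ i b, φ (c i * b) = 0 := by
    intro a ha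
    obtain ⟨c, hc⟩ := hrep a
    refine ⟨c, hc, fun i b => ?_⟩
    have h1 := contract_comul_mul_tmul_one φ hφ a b
    have h2 : φ ∘ₗ LinearMap.mulLeft k a = 0 := by ext b; simpa using ha b
    have h3 : hit (0 : Module.Dual k A) b = 0 := by simp [hit_apply, contract]
    rw [h2, h3, map_zero, hc, Finset.sum_mul, map_sum] at h1
    simp only [Algebra.TensorProduct.tmul_mul_tmul, mul_one, contract_tmul] at h1
    exact Fintype.linearIndependent_iff.mp B.linearIndependent _ h1 i
  -- On `J` the counit vanishes: `ε(a) 1 = a₁ S(a₂)` with `a₁ ∈ J`, so `ε(a) φ(b) = 0` for all `b`,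
  -- while `φ ≠ 0`. Then `a = ε(a₁) a₂ = 0`.
  have hε : ∀ a : A, (∀ b, φ (a * b) = 0) → Coalgebra.counit (R := k) a = 0 := by
    intro a ha
    obtain ⟨c, hc, hcJ⟩ := hrepJ a ha
    by_contra hne'
    apply hne
    have h1 := HopfAlgebra.mul_antipode_lTensor_comul_apply (R := k) a
    rw [hc] at h1
    simp only [map_sum, LinearMap.lTensor_tmul, LinearMap.mul'_apply] at h1
    ext b
    have h2 : φ (algebraMap k A (Coalgebra.counit (R := k) a) * b) = 0 := by
      rw [← h1, Finset.sum_mul, map_sum]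
      exact Finset.sum_eq_zero fun i _ => by rw [mul_assoc, hcJ]
    rw [Algebra.algebraMap_eq_smul_one, smul_one_mul, map_smul, smul_eq_mul] at h2
    simpa [hne'] using h2
  obtain ⟨c, hc, hcJ⟩ := hrepJ a ha
  rw [← hit_counit (k := k) a, hit_apply, hc, map_sum]
  exact Finset.sum_eq_zero fun i _ => by rw [contract_tmul, hε _ (hcJ i), zero_smul]

theorem bijective_dual_of_integral [FiniteDimensional k A] (φ : Module.Dual k A) (hne : φ ≠ 0)
    (hφ : ∀ h, hit φ h = φ h • (1 : A)) :
    Function.Bijective ((LinearMap.mul k A).compr₂ φ) := by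
  have hinj : Function.Injective ((LinearMap.mul k A).compr₂ φ) := by
    rw [← LinearMap.ker_eq_bot, LinearMap.ker_eq_bot']
    intro a ha
    exact eq_zero_of_forall_mul_eq_zero φ hne hφ fun b => LinearMap.congr_fun ha b
  exact ⟨hinj, (LinearMap.injective_iff_surjective_of_finrank_eq_finrank
    (Subspace.dual_finrank_eq (K := k) (V := A)).symm).mp hinj⟩

theorem eq_zero_of_forall_mul_eq_zero' [FiniteDimensional k A] (φ : Module.Dual k A) (hne : φ ≠ 0)
    (hφ : ∀ h, hit φ h = φ h • (1 : A)) {a : A} (ha : ∀ b, φ (b * a) = 0) : a = 0 := by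
  rw [← Module.forall_dual_apply_eq_zero_iff k]
  intro f
  obtain ⟨b, rfl⟩ := (bijective_dual_of_integral φ hne hφ).2 f
  exact ha b

/-- A nonzero right integral in the dual of a finite-dimensional Hopf algebra determines a Nakayama
automorphism, a right integral and a modular element. -/
theorem nonempty_nakayamaData [FiniteDimensional k A] (φ : Module.Dual k A) (hne : φ ≠ 0)
    (hφ : ∀ h, hit φ h = φ h • (1 : A)) : Nonempty (NakayamaData k A) := by
  have hbij := bijective_dual_of_integral φ hne hφ
  have hext : ∀ {a b : A}, (∀ c, φ (a * c) = φ (b * c)) → a = b := fun h =>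
    hbij.1 (LinearMap.ext h)
  have hsurj : ∀ f : Module.Dual k A, ∃ a : A, ∀ b, φ (a * b) = f b := by
    intro f
    obtain ⟨a, rfl⟩ := hbij.2 f
    exact ⟨a, fun _ => rfl⟩
  -- `r(a)` is the element representing the functional `b ↦ φ(b a)`; uniqueness of representing
  -- elements makes `r` an algebra map.
  choose r hr using fun a : A => hsurj (φ ∘ₗ LinearMap.mulRight k a)
  replace hr : ∀ a b, φ (r a * b) = φ (b * a) := hr
  let R : A →ₐ[k] A := AlgHom.ofLinearMap
    { toFun := r
      map_add' := fun a b => hext fun c => by rw [add_mul, map_add, hr, hr, hr, mul_add, map_add]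
      map_smul' := fun s a => hext fun c => by
        rw [RingHom.id_apply, smul_mul_assoc, map_smul, hr, hr, mul_smul_comm, map_smul] }
    (hext fun c => by simp [hr])
    (fun a b => hext fun c => by
      change φ (r (a * b) * c) = φ (r a * r b * c)
      rw [hr, mul_assoc, hr, mul_assoc, hr, mul_assoc])
  have hR : Function.Injective R := by
    rw [injective_iff_map_eq_zero]
    intro a ha
    refine eq_zero_of_forall_mul_eq_zero' φ hne hφ fun b => ?_
    rw [← hr, show r a = 0 from ha, zero_mul, map_zero]
  have hR' : Function.Bijective R :=
    ⟨hR, (LinearMap.injective_iff_surjective (f := R.toLinearMap)).mp hR⟩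
  obtain ⟨t, ht⟩ := hsurj (Coalgebra.counit (R := k))
  have htr : IsRightIntegral k A t := fun a => hext fun c => by
    rw [mul_assoc, ht, Bialgebra.counit_mul, smul_mul_assoc, map_smul, ht, smul_eq_mul]
  -- `t` represents `ε`, so right integrals form a line; `a t` is again a right integral, which
  -- produces the scalar `α(a) = φ(a t)`.
  have hprop : ∀ s : A, IsRightIntegral k A s → s = φ s • t := fun s hs => hext fun c => by
    rw [hs, map_smul, smul_mul_assoc, map_smul, ht, smul_eq_mul, smul_eq_mul, mul_comm]
  have hφt : φ t = 1 := by simpa using ht 1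
  have ht0 : t ≠ 0 := by rintro rfl; simp at hφt
  have hα : ∀ a : A, a * t = φ (a * t) • t := fun a => hprop _ fun b => by
    rw [mul_assoc, htr, mul_smul_comm]
  let α : A →ₐ[k] k := AlgHom.ofLinearMap (φ ∘ₗ LinearMap.mulRight k t) (by simp [hφt])
    (fun a b => by
      change φ (a * b * t) = φ (a * t) * φ (b * t)
      rw [mul_assoc, hα b, mul_smul_comm, map_smul, smul_eq_mul, map_smul, hφt, smul_eq_mul,
        mul_one, mul_comm])
  exact ⟨{ φ := φ, φ_ne_zero := hne, φ_integral := (isDualRightIntegral_iff φ).mpr hφ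
           ρ := AlgEquiv.ofBijective R hR', φ_mul := fun a b => (hr a b).symm
           t := t, t_ne_zero := ht0, t_integral := htr, α := α, mul_t := hα }⟩

/-! ### Identities linking the two integrals, `ρ` and `α` -/

namespace NakayamaData
variable (N : NakayamaData k A)

theorem hit_φ (h : A) : hit N.φ h = N.φ h • (1 : A) :=
  (isDualRightIntegral_iff N.φ).mp N.φ_integral h

/-- Otherwise `φ(t b) = ε(b) φ(t) = 0` for all `b`, against nondegeneracy of `φ`. -/
theorem φ_t_ne_zero [FiniteDimensional k A] : N.φ N.t ≠ 0 := by
  intro h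
  refine N.t_ne_zero (eq_zero_of_forall_mul_eq_zero N.φ N.φ_ne_zero N.hit_φ fun b => ?_)
  rw [N.t_integral, map_smul, h, smul_zero]

/-- `φ(t₁ b) t₂ = φ(t) S(b)`. -/
theorem contract_comul_t_mul (b : A) : contract N.φ (Coalgebra.comul (R := k) N.t * b ⊗ₜ 1)
    = N.φ N.t • HopfAlgebra.antipode k b := by
  have h : N.φ ∘ₗ LinearMap.mulLeft k N.t = N.φ N.t • Coalgebra.counit := by
    ext b
    simp [N.t_integral b, mul_comm]
  have h' : hit (N.φ N.t • Coalgebra.counit : Module.Dual k A) b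
      = N.φ N.t • hit (Coalgebra.counit (R := k)) b := by
    simp [hit_apply, contract, LinearMap.rTensor_smul]
  rw [contract_comul_mul_tmul_one _ N.hit_φ, h, h', hit_counit, map_smul]

/-- `φ(ρ(a) t₁) t₂ = φ(t) S(a)`. -/
theorem contract_ρ_mul_comul_t (a : A) : contract N.φ (N.ρ a ⊗ₜ 1 * Coalgebra.comul (R := k) N.t)
    = N.φ N.t • HopfAlgebra.antipode k a := by
  rw [← contract_comul_t_mul, contract_tmul_one_mul, contract_mul_tmul_one]
  congr 2
  exact LinearMap.ext fun b => (N.φ_mul a b).symm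

theorem comul_mul_comul_t (a : A) : Coalgebra.comul (R := k) a * Coalgebra.comul (R := k) N.t
    = N.α a • Coalgebra.comul (R := k) N.t := by
  rw [← Bialgebra.comul_mul, N.mul_t, map_smul]

end NakayamaData

end Hopf

/-! ### Finite-dimensionality -/

section Finite
variable {k : Type u} [Field k] {A : Type v} [Ring A] [Algebra k A]

/-- Only the top power of `x` is new when the exponent of the span of `1, x` grows; once that power
lies in a subalgebra, higher exponents add nothing. -/
theorem span_one_self_pow_succ_le (x : A) (m : ℕ) :
    Submodule.span k {1, x} ^ (m + 1)
      ≤ Submodule.span k {1, x} ^ m ⊔ Submodule.span k {x ^ (m + 1)} := by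
  induction m with
  | zero =>
    rw [zero_add, pow_one, pow_one, pow_zero, Submodule.one_eq_span, ← Submodule.span_union]
    exact Submodule.span_mono (by rintro y (rfl | rfl) <;> simp)
  | succ m ih =>
    have hV : Submodule.span k {1, x} = 1 ⊔ Submodule.span k {x} := by
      rw [Submodule.one_eq_span, ← Submodule.span_union]; rfl
    have hx : Submodule.span k {x} ≤ Submodule.span k {1, x} := Submodule.span_mono (by simp)
    calc Submodule.span k {1, x} ^ (m + 1 + 1)
        = Submodule.span k {1, x} ^ (m + 1) * (1 ⊔ Submodule.span k {x}) := by
          rw [pow_succ _ (m + 1), ← hV]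
      _ = Submodule.span k {1, x} ^ (m + 1) ⊔
            Submodule.span k {1, x} ^ (m + 1) * Submodule.span k {x} := by
          rw [Submodule.mul_sup, mul_one]
      _ ≤ _ := by
          refine sup_le le_sup_left ((mul_le_mul' ih le_rfl).trans ?_)
          rw [Submodule.sup_mul, Submodule.span_mul_span, Set.singleton_mul_singleton,
            ← pow_succ x]
          refine sup_le_sup_right ?_ _
          rw [pow_succ]
          exact mul_le_mul' le_rfl hx

/-- Adjoining to a finite-dimensional subalgebra `B` an element `x` with `x B ⊆ B x + B` and
`x ^ m ∈ B` gives a finite-dimensional subalgebra. -/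
theorem exists_finite_submodule_of_pow_mem (B : Subalgebra k A)
    [hB : Module.Finite k (Subalgebra.toSubmodule B)] {x : A} {m : ℕ} (hx : x ^ (m + 1) ∈ B)
    (hxB : ∀ b ∈ B, x * b ∈ Subalgebra.toSubmodule B * Submodule.span k {1, x}) :
    ∃ C : Subalgebra k A, B ≤ C ∧ x ∈ C ∧ Module.Finite k (Subalgebra.toSubmodule C) := by
  set V := Submodule.span k {1, x} with hVdef
  set M := Subalgebra.toSubmodule B with hM
  have h1V : (1 : Submodule k A) ≤ V := by
    rw [Submodule.one_eq_span]; exact Submodule.span_mono (by simp)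
  have h1M : (1 : Submodule k A) ≤ M := by
    rw [Submodule.one_eq_span, Submodule.span_singleton_le_iff_mem]; exact B.one_mem
  have hMM : M * M = M := B.isIdempotentElem_toSubmodule.eq
  have hVM : V * M ≤ M * V := by
    rw [hVdef, Submodule.mul_le]
    intro v hv b hb
    obtain ⟨c, d, rfl⟩ := Submodule.mem_span_pair.mp hv
    rw [add_mul, smul_mul_assoc, smul_mul_assoc, one_mul]
    refine add_mem (Submodule.smul_mem _ _ ?_) (Submodule.smul_mem _ _ (hxB b hb))
    exact (by simpa using mul_le_mul' (le_refl M) h1V : M ≤ M * V) hb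
  have hVnM : ∀ j : ℕ, V ^ j * M ≤ M * V ^ j := by
    intro j
    induction j with
    | zero => simp
    | succ j ih =>
      calc V ^ (j + 1) * M = V ^ j * (V * M) := by rw [pow_succ, mul_assoc]
        _ ≤ V ^ j * (M * V) := mul_le_mul' le_rfl hVM
        _ = V ^ j * M * V := by rw [mul_assoc]
        _ ≤ M * V ^ j * V := mul_le_mul' ih le_rfl
        _ = _ := by rw [mul_assoc, pow_succ]
  -- The required subalgebra is `M V^m`. It is closed under products because `V` moves past `M` and
  -- because `x ^ (m + 1) ∈ B` brings `V ^ (m + 1)` back into `M V^m`.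
  have hred : ∀ j : ℕ, M * V ^ (m + j) ≤ M * V ^ m := by
    intro j
    induction j with
    | zero => simp
    | succ j ih =>
      have h1 : V ^ (m + 1) ≤ M * V ^ m := by
        refine (span_one_self_pow_succ_le x m).trans (sup_le ?_ ?_)
        · simpa using mul_le_mul' h1M (le_refl (V ^ m))
        · rw [Submodule.span_singleton_le_iff_mem]
          have h2 : (1 : Submodule k A) ≤ V ^ m := by simpa using pow_le_pow_left' h1V m
          exact (by simpa using mul_le_mul' (le_refl M) h2 : M ≤ M * V ^ m) hx
      calc M * V ^ (m + (j + 1)) = M * V ^ (m + j) * V := by rw [← add_assoc, pow_succ, mul_assoc]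
        _ ≤ M * V ^ m * V := mul_le_mul' ih le_rfl
        _ = M * V ^ (m + 1) := by rw [mul_assoc, pow_succ]
        _ ≤ M * (M * V ^ m) := mul_le_mul' le_rfl h1
        _ = M * V ^ m := by rw [← mul_assoc, hMM]
  have hNN : (M * V ^ m) * (M * V ^ m) ≤ M * V ^ m :=
    calc (M * V ^ m) * (M * V ^ m) = M * (V ^ m * M) * V ^ m := by simp only [mul_assoc]
      _ ≤ M * (M * V ^ m) * V ^ m :=
          mul_le_mul' (mul_le_mul' le_rfl (hVnM m)) le_rfl
      _ = M * V ^ (m + m) := by rw [← mul_assoc, hMM, mul_assoc, pow_add]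
      _ ≤ _ := hred m
  have hMN : M ≤ M * V ^ m := by
    have h2 : (1 : Submodule k A) ≤ V ^ m := by simpa using pow_le_pow_left' h1V m
    simpa using mul_le_mul' (le_refl M) h2
  refine ⟨(M * V ^ m).toSubalgebra (hMN B.one_mem)
    (fun a b ha hb => hNN (Submodule.mul_mem_mul ha hb)), hMN, ?_, ?_⟩
  · have h1 : V ≤ M * V ^ (m + 1) :=
      calc V = 1 * V ^ 1 := by simp
        _ ≤ M * V ^ (m + 1) := mul_le_mul' h1M (pow_le_pow_right' h1V (by omega))
    exact hred 1 (h1 (Submodule.subset_span (by simp)))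
  · rw [Submodule.toSubalgebra_toSubmodule]
    have hV : V.FG := Submodule.fg_span (by simp)
    exact Module.Finite.iff_fg.mpr ((Module.Finite.iff_fg.mp hB).mul (hV.pow m))

end Finite

/-! ### Finite-dimensionality of the lifting and injectivity of its antipode -/

namespace Datum
variable {k : Type u} [Field k] {G : Type v} [CommGroup G] {n : ℕ} (D : Datum k G n)

theorem of_mul_of_inv (a : G) : D.of a * D.of a⁻¹ = 1 := by
  rw [← map_mul, mul_inv_cancel, map_one]

theorem of_inv_mul_of (a : G) : D.of a⁻¹ * D.of a = 1 := by
  rw [← map_mul, inv_mul_cancel, map_one]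

/-- The span of the group elements in `H`. -/
def groupSpan : Submodule k D.H := Submodule.span k (Set.range D.of)

theorem of_mem_groupSpan (a : G) : D.of a ∈ D.groupSpan := Submodule.subset_span ⟨a, rfl⟩

/-- The subalgebra generated by `G` and the `x_i`, `i ∈ s`. -/
def partialSubalgebra (s : Finset (Fin n)) : Subalgebra k D.H :=
  Algebra.adjoin k (Set.range D.of ∪ D.x '' s)

theorem of_mem_partialSubalgebra (s : Finset (Fin n)) (a : G) : D.of a ∈ D.partialSubalgebra s :=
  Algebra.subset_adjoin (Or.inl ⟨a, rfl⟩)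

/-- Moving `x_i` to the right past a generator costs a scalar and, for the linking relation, an
element of the subalgebra. The condition `i ∉ s` ensures that only linking relations with distinct
indices occur. -/
theorem x_mul_mem {s : Finset (Fin n)} {i : Fin n} (hi : i ∉ s) {b : D.H}
    (hb : b ∈ D.partialSubalgebra s) : D.x i * b ∈
      Subalgebra.toSubmodule (D.partialSubalgebra s) * Submodule.span k {1, D.x i} := by
  set B := D.partialSubalgebra s with hBdef
  have hBx : ∀ b ∈ B, b * D.x i ∈ Subalgebra.toSubmodule B * Submodule.span k {1, D.x i} :=
    fun b hb => Submodule.mul_mem_mul hb (Submodule.subset_span (by simp))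
  have hB1 : ∀ b ∈ B, b ∈ Subalgebra.toSubmodule B * Submodule.span k {1, D.x i} :=
    fun b hb => by
      simpa using Submodule.mul_mem_mul (M := Subalgebra.toSubmodule B) hb
        (Submodule.subset_span (by simp : (1 : D.H) ∈ ({1, D.x i} : Set D.H)))
  have hof : ∀ a, D.of a ∈ B := D.of_mem_partialSubalgebra s
  induction hb using Algebra.adjoin_induction with
  | mem y hy =>
    rcases hy with ⟨a, rfl⟩ | ⟨j, hj, rfl⟩
    · have h := D.x_mul_of_inv a⁻¹ i
      rw [inv_inv] at h
      rw [h]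
      exact Submodule.smul_mem _ _ (hBx _ (hof a))
    · have hij : i ≠ j := by rintro rfl; exact hi hj
      have hxj : D.x j ∈ B := Algebra.subset_adjoin (Or.inr ⟨j, hj, rfl⟩)
      rw [D.x_mul_x i j hij]
      exact add_mem (Submodule.smul_mem _ _ (hBx _ hxj))
        (Submodule.smul_mem _ _ (hB1 _ (sub_mem B.one_mem (hof _))))
  | algebraMap c =>
    rw [← Algebra.commutes]
    exact hBx _ (B.algebraMap_mem c)
  | add y z _ _ hy hz => rw [mul_add]; exact add_mem hy hz
  | mul y z hy' hz' hy hz =>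
    -- Passage to products: `x (y z) = (x y) z ∈ B V z ⊆ B V`, with `V` the span of `1, x`.
    have key : Subalgebra.toSubmodule B * Submodule.span k {1, D.x i} * Submodule.span k {z}
        ≤ Subalgebra.toSubmodule B * Submodule.span k {1, D.x i} := by
      rw [mul_assoc, Submodule.mul_le]
      intro b hb w hw
      rw [Submodule.span_mul_span] at hw
      induction hw using Submodule.span_induction with
      | mem w hw =>
        obtain ⟨p, hp, r, hr, rfl⟩ := hw
        obtain rfl := Set.mem_singleton_iff.mp hr
        rcases hp with rfl | rfl
        · simpa using hB1 _ (B.mul_mem hb hz')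
        · have h1 := Submodule.mul_mem_mul (M := Subalgebra.toSubmodule B) hb hz
          rw [← mul_assoc, B.isIdempotentElem_toSubmodule.eq] at h1
          exact h1
      | zero => simp
      | add p r _ _ hp hr => rw [mul_add]; exact add_mem hp hr
      | smul c p _ hp => rw [mul_smul_comm]; exact Submodule.smul_mem _ _ hp
    rw [← mul_assoc]
    exact key (Submodule.mul_mem_mul hy (Submodule.mem_span_singleton_self z))

/-- In the commutative field `k`, the relation `g_i x_i = χ_i(g_i) x_i g_i` with `χ_i(g_i) ≠ 1` and
`β(g_i)` invertible forces this. -/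
theorem algHom_x (β : D.H →ₐ[k] k) (i : Fin n) : β (D.x i) = 0 := by
  have h := congrArg β (D.of_mul_x (D.g i) i)
  rw [map_mul, map_smul, map_mul, smul_eq_mul] at h
  have hu : β (D.of (D.g i)) ≠ 0 := fun h0 => by
    have := congrArg β (map_mul D.of (D.g i) (D.g i)⁻¹)
    rw [mul_inv_cancel, map_one, map_one, map_mul, h0, zero_mul] at this
    exact one_ne_zero this
  have hne : (D.χ i (D.g i) : k) - 1 ≠ 0 := by
    rw [sub_ne_zero]
    exact fun h1 => D.χ_self_ne_one i (Units.ext h1)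
  have h2 : β (D.of (D.g i)) * ((D.χ i (D.g i) : k) - 1) * β (D.x i) = 0 := by
    linear_combination -h
  exact (mul_eq_zero.mp h2).resolve_left (mul_ne_zero hu hne)

variable [Finite G]

theorem finite_partialSubalgebra (s : Finset (Fin n)) :
    Module.Finite k (Subalgebra.toSubmodule (D.partialSubalgebra s)) := by
  induction s using Finset.induction_on with
  | empty =>
    have h : D.groupSpan * D.groupSpan ≤ D.groupSpan := by
      rw [groupSpan, Submodule.span_mul_span]
      apply Submodule.span_mono
      rintro _ ⟨_, ⟨a, rfl⟩, _, ⟨b, rfl⟩, rfl⟩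
      exact ⟨a * b, map_mul _ _ _⟩
    let C := D.groupSpan.toSubalgebra (by simpa using D.of_mem_groupSpan 1)
      (fun a b ha hb => h (Submodule.mul_mem_mul ha hb))
    have hle : D.partialSubalgebra ∅ ≤ C := by
      rw [partialSubalgebra, Algebra.adjoin_le_iff]
      rintro _ (⟨a, rfl⟩ | ⟨j, hj, _⟩)
      · exact D.of_mem_groupSpan a
      · simp at hj
    have : FiniteDimensional k D.groupSpan := FiniteDimensional.span_of_finite k (Set.finite_range _)
    exact Submodule.finiteDimensional_of_le (S₂ := D.groupSpan) hle
  | insert i s hi ih =>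
    obtain ⟨m, hm⟩ : ∃ m, D.m i = m + 1 := ⟨D.m i - 1, by have := D.m_pos i; omega⟩
    obtain ⟨C, hBC, hxC, hC⟩ := exists_finite_submodule_of_pow_mem (D.partialSubalgebra s)
      (x := D.x i) (m := m)
      (by
        rw [← hm, D.x_pow]
        exact Subalgebra.smul_mem _ (sub_mem (one_mem _) (D.of_mem_partialSubalgebra s _)) _)
      (fun b hb => D.x_mul_mem hi hb)
    have hle : D.partialSubalgebra (insert i s) ≤ C := by
      rw [partialSubalgebra, Algebra.adjoin_le_iff]
      rintro _ (⟨a, rfl⟩ | ⟨j, hj, rfl⟩)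
      · exact hBC (D.of_mem_partialSubalgebra s a)
      · rcases Finset.mem_insert.mp hj with rfl | hj
        · exact hxC
        · exact hBC (Algebra.subset_adjoin (Or.inr ⟨j, hj, rfl⟩))
    exact Submodule.finiteDimensional_of_le (S₂ := Subalgebra.toSubmodule C) hle

instance : FiniteDimensional k D.H := by
  have h := D.finite_partialSubalgebra Finset.univ
  have htop : Subalgebra.toSubmodule (D.partialSubalgebra Finset.univ) = ⊤ := by
    rw [eq_top_iff]
    intro y _
    induction y using D.induction with
    | halg c => exact Subalgebra.algebraMap_mem _ c
    | hof a => exact D.of_mem_partialSubalgebra _ a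
    | hx i => exact Algebra.subset_adjoin (Or.inr ⟨i, by simp, rfl⟩)
    | hmul a b ha hb => exact (D.partialSubalgebra _).mul_mem (ha trivial) (hb trivial)
    | hadd a b ha hb => exact add_mem (ha trivial) (hb trivial)
  rw [htop] at h
  exact Module.Finite.equiv (Submodule.topEquiv)

/-- By finite dimension surjectivity suffices. The image is closed under products, since `S`
reverses them, and it contains the generators. -/
theorem antipodeLin_injective : Function.Injective D.antipodeLin := by
  rw [LinearMap.injective_iff_surjective]
  intro y
  induction y using D.induction with
  | halg c => exact ⟨algebraMap k D.H c, by simp [Algebra.algebraMap_eq_smul_one]⟩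
  | hof a => exact ⟨D.of a⁻¹, by simp⟩
  | hx i =>
    refine ⟨-(D.x i * D.of (D.g i)⁻¹), ?_⟩
    rw [map_neg, antipodeLin_mul, antipodeLin_of, antipodeLin_x, mul_neg, neg_neg, ← mul_assoc,
      ← map_mul, inv_inv, mul_inv_cancel, map_one, one_mul]
  | hmul a b ha hb =>
    obtain ⟨c, rfl⟩ := ha
    obtain ⟨d, rfl⟩ := hb
    exact ⟨d * c, D.antipodeLin_mul d c⟩
  | hadd a b ha hb =>
    obtain ⟨c, rfl⟩ := ha
    obtain ⟨d, rfl⟩ := hb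
    exact ⟨c + d, map_add _ _ _⟩

end Datum

namespace Datum
variable {k : Type u} [Field k] {G : Type v} [CommGroup G] [Finite G] {n : ℕ} (D : Datum k G n)

/-! ### Existence of an integral in the dual -/

theorem hit_of (f : Module.Dual k D.H) (a : G) : hit f (D.of a) = f (D.of a) • D.of a := by
  simp [hit_apply, comul_eq]

theorem hit_mul_of (f : Module.Dual k D.H) (h : D.H) (a : G) :
    hit f (h * D.of a) = hit (f ∘ₗ LinearMap.mulRight k (D.of a)) h * D.of a := by
  have e : D.of a ⊗ₜ[k] D.of a = D.of a ⊗ₜ 1 * 1 ⊗ₜ D.of a := by simp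
  rw [hit_apply, Bialgebra.comul_mul, comul_eq D (D.of a), comulHom_of, e, ← mul_assoc,
    contract_mul_one_tmul, contract_mul_tmul_one, hit_apply]

theorem hit_mul_x (f : Module.Dual k D.H) (h : D.H) (i : Fin n) :
    hit f (h * D.x i) = hit (f ∘ₗ LinearMap.mulRight k (D.of (D.g i))) h * D.x i
      + hit (f ∘ₗ LinearMap.mulRight k (D.x i)) h := by
  have e : D.of (D.g i) ⊗ₜ[k] D.x i = D.of (D.g i) ⊗ₜ 1 * 1 ⊗ₜ D.x i := by simp
  rw [hit_apply, Bialgebra.comul_mul, comul_eq D (D.x i), comulHom_x, e, mul_add, ← mul_assoc,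
    map_add, contract_mul_one_tmul, contract_mul_tmul_one, contract_mul_tmul_one, hit_apply,
    hit_apply]

/-- The filtration of `H` by iterated wedges of the span of `G`. -/
def wedge : ℕ → Submodule k D.H
  | 0 => D.groupSpan
  | m + 1 => ⨅ f : {f : Module.Dual k D.H // ∀ a, f (D.of a) = 0}, (wedge m).comap (hit f.1)

theorem mem_wedge_succ {m : ℕ} {h : D.H} : h ∈ D.wedge (m + 1) ↔
    ∀ f : Module.Dual k D.H, (∀ a, f (D.of a) = 0) → hit f h ∈ D.wedge m := by
  simp [wedge]

/-- Two successive actions are a single one, by `e ∘ hit f`, and this functional vanishes on `G` as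
soon as `e` does. -/
theorem hit_mem_wedge {m : ℕ} (f : Module.Dual k D.H) {h : D.H} (hh : h ∈ D.wedge m) :
    hit f h ∈ D.wedge m := by
  induction m generalizing f with
  | zero =>
    have : D.groupSpan ≤ D.groupSpan.comap (hit f) := by
      conv_lhs => rw [groupSpan]
      rw [Submodule.span_le]
      rintro _ ⟨a, rfl⟩
      rw [SetLike.mem_coe, Submodule.mem_comap, hit_of]
      exact Submodule.smul_mem _ _ (D.of_mem_groupSpan a)
    exact this hh
  | succ m ih =>
    rw [mem_wedge_succ] at hh ⊢
    intro e he
    rw [hit_hit]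
    exact hh _ fun a => by simp [hit_of, he]

theorem wedge_le_succ (m : ℕ) : D.wedge m ≤ D.wedge (m + 1) := by
  intro h hh
  rw [mem_wedge_succ]
  exact fun f _ => D.hit_mem_wedge f hh

theorem wedge_mono : Monotone D.wedge := monotone_nat_of_le_succ D.wedge_le_succ

theorem mul_of_mem_wedge {m : ℕ} {h : D.H} (hh : h ∈ D.wedge m) (a : G) :
    h * D.of a ∈ D.wedge m := by
  induction m generalizing h with
  | zero =>
    have : D.groupSpan ≤ D.groupSpan.comap (LinearMap.mulRight k (D.of a)) := by
      conv_lhs => rw [groupSpan]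
      rw [Submodule.span_le]
      rintro _ ⟨b, rfl⟩
      simpa using D.of_mem_groupSpan (b * a)
    exact this hh
  | succ m ih =>
    rw [mem_wedge_succ] at hh ⊢
    intro f hf
    rw [hit_mul_of]
    exact ih (hh _ fun b => by simp [← map_mul, hf])

/-- If `f` vanishes on `G`, so does `f(· g_i)`; thus the term of `hit f (h x_i)` that keeps the
factor `x_i` has its other factor one step lower, and the remaining term stays in degree `m`. -/
theorem mul_x_mem_wedge {m : ℕ} {h : D.H} (hh : h ∈ D.wedge m) (i : Fin n) :
    h * D.x i ∈ D.wedge (m + 1) := by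
  induction m generalizing h with
  | zero =>
    rw [mem_wedge_succ]
    intro f hf
    rw [hit_mul_x]
    refine add_mem ?_ (D.hit_mem_wedge _ hh)
    have : hit (f ∘ₗ LinearMap.mulRight k (D.of (D.g i))) h = 0 := by
      have hle : D.groupSpan ≤ LinearMap.ker (hit (f ∘ₗ LinearMap.mulRight k (D.of (D.g i)))) := by
        rw [groupSpan, Submodule.span_le]
        rintro _ ⟨b, rfl⟩
        rw [SetLike.mem_coe, LinearMap.mem_ker, hit_of]
        simp [← map_mul, hf]
      exact hle hh
    rw [this, zero_mul]
    exact zero_mem _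
  | succ m ih =>
    rw [mem_wedge_succ]
    intro f hf
    rw [hit_mul_x]
    refine add_mem (ih ?_) (D.hit_mem_wedge _ hh)
    exact D.mem_wedge_succ.mp hh _ fun b => by simp [← map_mul, hf]

theorem exists_mem_wedge (h : D.H) : ∃ m, h ∈ D.wedge m := by
  have key : ∀ y : D.H, ∀ m, ∀ h ∈ D.wedge m, ∃ m', h * y ∈ D.wedge m' := by
    intro y
    induction y using D.induction with
    | halg c =>
      intro m h hh
      refine ⟨m, ?_⟩
      rw [← Algebra.commutes, ← Algebra.smul_def]
      exact Submodule.smul_mem _ _ hh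
    | hof a => exact fun m h hh => ⟨m, D.mul_of_mem_wedge hh a⟩
    | hx i => exact fun m h hh => ⟨m + 1, D.mul_x_mem_wedge hh i⟩
    | hmul a b ha hb =>
      intro m h hh
      obtain ⟨m', h'⟩ := ha m h hh
      rw [← mul_assoc]
      exact hb m' _ h'
    | hadd a b ha hb =>
      intro m h hh
      obtain ⟨m₁, h₁⟩ := ha m h hh
      obtain ⟨m₂, h₂⟩ := hb m h hh
      rw [mul_add]
      exact ⟨max m₁ m₂, add_mem (D.wedge_mono (le_max_left _ _) h₁)
        (D.wedge_mono (le_max_right _ _) h₂)⟩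
  have h1 : (1 : D.H) ∈ D.wedge 0 := map_one D.of ▸ D.of_mem_groupSpan 1
  simpa using key h 0 1 h1

theorem exists_wedge_eq_top : ∃ m, D.wedge m = ⊤ := by
  choose f hf using fun i => D.exists_mem_wedge (Module.finBasis k D.H i)
  refine ⟨Finset.univ.sup f, ?_⟩
  rw [eq_top_iff, ← (Module.finBasis k D.H).span_eq, Submodule.span_le]
  rintro _ ⟨i, rfl⟩
  exact D.wedge_mono (Finset.le_sup (Finset.mem_univ i)) (hf i)

instance : Nontrivial D.H := D.counitHom.toRingHom.domain_nontrivial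

/-- Take `f ≠ 0` with all `hit f h` in `wedge m`, `m` minimal. If `m > 0` and some `hit f h` were
outside the span of `G`, a functional `e` vanishing on `G` but not at `hit f h` would make `e ∘ hit
f` a nonzero functional for `m - 1`. -/
theorem exists_hit_mem_groupSpan :
    ∃ f : Module.Dual k D.H, f ≠ 0 ∧ ∀ h, hit f h ∈ D.groupSpan := by
  classical
  have hex : ∃ m, ∃ f : Module.Dual k D.H, f ≠ 0 ∧ ∀ h, hit f h ∈ D.wedge m := by
    obtain ⟨m, hm⟩ := D.exists_wedge_eq_top
    refine ⟨m, Coalgebra.counit, fun h => ?_, fun h => by simp [hm]⟩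
    have := LinearMap.congr_fun h (1 : D.H)
    simp at this
  obtain ⟨f, hf, hfm⟩ := Nat.find_spec hex
  cases hm : Nat.find hex with
  | zero =>
    rw [hm] at hfm
    exact ⟨f, hf, hfm⟩
  | succ m =>
    rw [hm] at hfm
    refine ⟨f, hf, fun h => ?_⟩
    by_contra hh
    obtain ⟨e, he, hmap⟩ := Submodule.exists_dual_map_eq_bot_of_notMem hh inferInstance
    have he' : ∀ a, e (D.of a) = 0 := fun a => by
      have : e (D.of a) ∈ D.groupSpan.map e := ⟨_, D.of_mem_groupSpan a, rfl⟩
      rw [hmap] at this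
      exact (Submodule.mem_bot k).mp this
    refine Nat.find_min hex (m := m) (by omega) ⟨e ∘ₗ hit f, fun h0 => he ?_, fun h' => ?_⟩
    · exact LinearMap.congr_fun h0 h
    · rw [← hit_hit]
      exact D.mem_wedge_succ.mp (hfm h') e he'

theorem exists_dual_integral :
    ∃ φ : Module.Dual k D.H, φ ≠ 0 ∧ ∀ h, hit φ h = φ h • (1 : D.H) := by
  obtain ⟨f, hf, hfG⟩ := D.exists_hit_mem_groupSpan
  -- Grouplike elements are independent. Working with the set of images of `G` avoids needing `G →
  -- H` to be injective.
  have hli : LinearIndepOn k id (Set.range D.of) := by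
    refine (linearIndepOn_isGroupLikeElem (R := k) (A := D.H)).mono ?_
    rintro _ ⟨a, rfl⟩
    exact ⟨by simp [counit_eq], by simp [comul_eq]⟩
  let B := Module.Basis.extend hli
  obtain ⟨h₀, hh₀⟩ : ∃ h, f h ≠ 0 := by
    by_contra! hcon
    exact hf (LinearMap.ext hcon)
  have hne : hit f h₀ ≠ 0 := fun h0 => hh₀ (by rw [← counit_hit, h0, map_zero])
  obtain ⟨e, he⟩ : ∃ e, B.coord e (hit f h₀) ≠ 0 := by
    by_contra! hcon
    exact hne (B.forall_coord_eq_zero_iff.mp hcon)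
  have hBe : ∀ e, B e = e := fun e => Module.Basis.extend_apply_self hli e
  have hcoord : ∀ a : G, B.coord e (D.of a) = 0 ∨ (e : D.H) = D.of a := by
    intro a
    have ha : D.of a ∈ hli.extend (Set.subset_univ _) := hli.subset_extend _ ⟨a, rfl⟩
    have h1 : B ⟨D.of a, ha⟩ = D.of a := hBe _
    by_cases hea : (e : D.H) = D.of a
    · exact Or.inr hea
    · left
      rw [← h1, Module.Basis.coord_apply, Module.Basis.repr_self, Finsupp.single_eq_of_ne]
      intro h
      exact hea (by rw [h])
  -- A coordinate at a basis vector outside the image of `G` would vanish on the whole span of `G`,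
  -- which contains `hit f h₀`.
  obtain ⟨a, ha⟩ : ∃ a, (e : D.H) = D.of a := by
    by_contra! hcon
    have hle : D.groupSpan ≤ LinearMap.ker (B.coord e) := by
      rw [groupSpan, Submodule.span_le]
      rintro _ ⟨a, rfl⟩
      exact (hcoord a).resolve_right (hcon a)
    exact he (hle (hfG h₀))
  have hhit : ∀ y ∈ D.groupSpan, hit (B.coord e) y = B.coord e y • D.of a := by
    intro y hy
    induction hy using Submodule.span_induction with
    | mem y hy =>
      obtain ⟨b, rfl⟩ := hy
      rw [hit_of]
      rcases hcoord b with h | h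
      · rw [h, zero_smul, zero_smul]
      · rw [← h, ha]
    | zero => simp
    | add y z _ _ hy hz => rw [map_add, map_add, hy, hz, add_smul]
    | smul c y _ hy => rw [map_smul, map_smul, hy, smul_assoc]
  let ψ : Module.Dual k D.H := B.coord e ∘ₗ hit f
  have hψ : ∀ h, hit ψ h = ψ h • D.of a := fun h => by
    rw [← hit_hit, hhit _ (hfG h)]; rfl
  -- From `ψ(h₁) h₂ = ψ(h) g` follows `ψ(g h₁) h₂ = g⁻¹ ψ(g h) g = ψ(g h) 1`.
  refine ⟨ψ ∘ₗ LinearMap.mulLeft k (D.of a), fun h0 => he ?_, fun h => ?_⟩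
  · have := LinearMap.congr_fun h0 (D.of a⁻¹ * h₀)
    simpa [← mul_assoc, of_mul_of_inv, ψ] using this
  · have e1 : D.of a ⊗ₜ[k] 1 = 1 ⊗ₜ D.of a⁻¹ * Coalgebra.comul (R := k) (D.of a) := by
      simp [comul_eq, of_inv_mul_of]
    rw [hit_apply, ← contract_tmul_one_mul, e1, mul_assoc, ← Bialgebra.comul_mul,
      contract_one_tmul_mul, ← hit_apply, hψ, mul_smul_comm, of_inv_mul_of]
    rfl

theorem nonempty_nakayamaData : Nonempty (NakayamaData k D.H) := by
  obtain ⟨φ, hne, hφ⟩ := D.exists_dual_integral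
  exact QLS.nonempty_nakayamaData φ hne hφ

/-! ### The Nakayama automorphism on the generators -/

variable (N : NakayamaData k D.H)

theorem αG_apply (a : G) : (D.αG N a : k) = N.α (D.of a) := rfl

theorem of_tmul_one_mul_comul_t (a : G) :
    D.of a ⊗ₜ[k] 1 * Coalgebra.comul (R := k) N.t
      = (D.αG N a : k) • (1 ⊗ₜ D.of a⁻¹ * Coalgebra.comul (R := k) N.t) := by
  have e1 : D.of a ⊗ₜ[k] 1 = 1 ⊗ₜ D.of a⁻¹ * Coalgebra.comul (R := k) (D.of a) := by
    simp [comul_eq, ← map_mul]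
  rw [e1, mul_assoc, N.comul_mul_comul_t, mul_smul_comm, αG_apply]

theorem hit_t : contract N.φ (Coalgebra.comul (R := k) N.t) = N.φ N.t • (1 : D.H) :=
  N.hit_φ N.t

/-- Reads off `ρ`: as `φ(t) ≠ 0` and `S` is injective, `φ(ρ(b) t₁) t₂ = φ(t) S(b)` determines `b`
from `ρ(b)`. -/
theorem ρ_eq_of_contract {a b : D.H}
    (h : contract N.φ (a ⊗ₜ 1 * Coalgebra.comul (R := k) N.t)
      = N.φ N.t • D.antipodeLin b) : N.ρ b = a := by
  have h1 := N.contract_ρ_mul_comul_t (N.ρ.symm a)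
  rw [AlgEquiv.apply_symm_apply, h] at h1
  have h2 : b = N.ρ.symm a := D.antipodeLin_injective (smul_right_injective _ N.φ_t_ne_zero h1)
  rw [h2, AlgEquiv.apply_symm_apply]

theorem ρ_of (a : G) : N.ρ (D.of a) = ((D.αG N a)⁻¹ : kˣ) • D.of a := by
  have h : N.ρ ((D.αG N a : k) • D.of a) = D.of a := by
    apply D.ρ_eq_of_contract N
    rw [D.of_tmul_one_mul_comul_t, map_smul, contract_one_tmul_mul, hit_t, map_smul,
      antipodeLin_of, mul_smul_comm, mul_one, smul_comm]
  rw [map_smul] at h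
  rw [eq_inv_smul_iff]
  exact h

theorem ρ_x (i : Fin n) :
    N.ρ (D.x i) = ((D.q i i * D.αG N (D.g i))⁻¹ : kˣ) • D.x i := by
  have h : N.ρ (((D.q i i * D.αG N (D.g i) : kˣ) : k) • D.x i) = D.x i := by
    apply D.ρ_eq_of_contract N
    -- Since `α(x_i) = 0`, this gives `(x_i ⊗ 1) Δ(t) = -(g_i ⊗ x_i) Δ(t) = -α(g_i) (1 ⊗ x_i g_i⁻¹)
    -- Δ(t)`; moving `g_i⁻¹` to the left produces the factor `q_ii`.
    have h1 := N.comul_mul_comul_t (D.x i)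
    have e1 : D.of (D.g i) ⊗ₜ[k] D.x i = 1 ⊗ₜ D.x i * D.of (D.g i) ⊗ₜ 1 := by simp
    rw [D.algHom_x, zero_smul, comul_eq D (D.x i), comulHom_x, e1, add_mul, mul_assoc,
      D.of_tmul_one_mul_comul_t] at h1
    rw [← neg_eq_iff_add_eq_zero.mpr h1, map_neg, mul_smul_comm, map_smul, contract_one_tmul_mul,
      contract_one_tmul_mul, hit_t, ← mul_assoc, D.x_mul_of_inv, map_smul, antipodeLin_x,
      mul_smul_comm, mul_one, smul_neg, smul_neg, smul_smul, smul_smul, smul_smul, Units.val_mul]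
    congr 2
    rw [q]
    ring
  rw [map_smul] at h
  rw [eq_inv_smul_iff]
  exact h

end Datum

theorem isDecomposition_of_iSupIndep {k A L : Type*} [Field k] [Ring A] [Algebra k A]
    {𝒜 : L → Submodule k A} (hind : iSupIndep 𝒜) (htop : ⨆ l, 𝒜 l = ⊤) : IsDecomposition k 𝒜 := by
  classical
  exact DirectSum.isInternal_submodule_of_iSupIndep_of_iSup_eq_top hind htop

theorem iSup_range_tmul_of {k B A L : Type*} [Field k] [AddCommGroup B] [Module k B]
    [AddCommGroup A] [Module k A] [Monoid L]
    (Φ : B ⊗[k] MonoidAlgebra k L ≃ₗ[k] A) :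
    ⨆ l, LinearMap.range (Φ.toLinearMap ∘ₗ
      (TensorProduct.mk k B (MonoidAlgebra k L)).flip (MonoidAlgebra.of k L l)) = ⊤ := by
  classical
  rw [eq_top_iff]
  intro h _
  obtain ⟨w, rfl⟩ := Φ.surjective h
  obtain ⟨b, rfl⟩ :=
    (TensorProduct.equivFinsuppOfBasisRight (M := B) (MonoidAlgebra.basis L k)).symm.surjective w
  rw [TensorProduct.equivFinsuppOfBasisRight_symm_apply, Finsupp.sum, map_sum]
  exact sum_mem fun l _ => Submodule.mem_iSup_of_mem l ⟨b l, rfl⟩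

namespace Datum
variable {k : Type u} [Field k] {G : Type v} [CommGroup G] [Finite G] {n : ℕ} (D : Datum k G n)
  (N : NakayamaData k D.H)

/-! ### The decomposition -/

theorem mem_component {ω : D.L₁ N} {h : D.H} :
    h ∈ D.component N ω ↔ N.ρ h = ((ω : kˣ) : k) • h :=
  Module.End.mem_eigenspace_iff

theorem αG_mem_L₁ (a : G) : D.αG N a ∈ D.L₁ N := Subgroup.subset_closure (Or.inr ⟨a, rfl⟩)

theorem q_mem_L₁ (i : Fin n) : D.q i i ∈ D.L₁ N := Subgroup.subset_closure (Or.inl ⟨i, rfl⟩)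

theorem L₂_le_L₁ : D.L₂ N ≤ D.L₁ N := by
  rintro _ ⟨a, rfl⟩
  exact D.αG_mem_L₁ N a

theorem mul_mem_component {ω ω' : D.L₁ N} {h h' : D.H} (hh : h ∈ D.component N ω)
    (hh' : h' ∈ D.component N ω') : h * h' ∈ D.component N (ω * ω') := by
  rw [mem_component] at *
  rw [map_mul, hh, hh', smul_mul_smul_comm]
  rfl

theorem of_mem_component (a : G) :
    D.of a ∈ D.component N ⟨(D.αG N a)⁻¹, inv_mem (D.αG_mem_L₁ N a)⟩ :=
  (D.mem_component N).mpr (D.ρ_of N a)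

theorem x_mem_component (i : Fin n) : D.x i ∈ D.component N
    ⟨(D.q i i * D.αG N (D.g i))⁻¹, inv_mem (mul_mem (D.q_mem_L₁ N i) (D.αG_mem_L₁ N _))⟩ :=
  (D.mem_component N).mpr (D.ρ_x N i)

theorem algebraMap_mem_component_one (c : k) : algebraMap k D.H c ∈ D.component N 1 := by
  rw [mem_component]
  simp

theorem iSupIndep_component : iSupIndep (D.component N) :=
  (Module.End.eigenspaces_iSupIndep N.ρ.toLinearMap).comp
    (f := fun ω : D.L₁ N => ((ω : kˣ) : k)) fun _ _ h => Subtype.ext (Units.ext h)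

theorem iSup_component : ⨆ ω, D.component N ω = ⊤ := by
  rw [eq_top_iff]
  intro h _
  induction h using D.induction with
  | halg c => exact Submodule.mem_iSup_of_mem _ (D.algebraMap_mem_component_one N c)
  | hof a => exact Submodule.mem_iSup_of_mem _ (D.of_mem_component N a)
  | hx i => exact Submodule.mem_iSup_of_mem _ (D.x_mem_component N i)
  | hadd a b ha hb => exact add_mem (ha trivial) (hb trivial)
  | hmul a b ha hb =>
    have key : (⨆ ω, D.component N ω) * (⨆ ω, D.component N ω) ≤ ⨆ ω, D.component N ω := by
      simp only [Submodule.iSup_mul, Submodule.mul_iSup]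
      refine iSup_le fun ω => iSup_le fun ω' => ?_
      rw [Submodule.mul_le]
      exact fun a ha b hb => Submodule.mem_iSup_of_mem _ (D.mul_mem_component N ha hb)
    exact key (Submodule.mul_mem_mul (ha trivial) (hb trivial))

theorem isDecomposition_component : IsDecomposition k (D.component N) :=
  isDecomposition_of_iSupIndep (D.iSupIndep_component N) (D.iSup_component N)

/-! ### The equivalences -/

theorem of_ne_zero (a : G) : D.of a ≠ 0 := fun h => by
  have := D.counitHom_of a
  rw [h, map_zero] at this
  exact zero_ne_one this

theorem ρ_pow_apply {c : k} {h : D.H} (hh : N.ρ h = c • h) (d : ℕ) : (N.ρ ^ d) h = c ^ d • h := by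
  induction d with
  | zero => simp
  | succ d ih => rw [pow_succ, AlgEquiv.mul_apply, hh, map_smul, ih, smul_smul, pow_succ']

/-- `ε` is fixed by the power of `ρ` whose exponent is the order of `α(G)`. -/
theorem counitHom_ρ_pow (h : D.H) :
    D.counitHom ((N.ρ ^ Nat.card (D.L₂ N)) h) = D.counitHom h := by
  have : D.counitHom.comp ((N.ρ ^ Nat.card (D.L₂ N) : D.H ≃ₐ[k] D.H) : D.H →ₐ[k] D.H)
      = D.counitHom := by
    apply D.algHom_ext
    · intro a
      have h1 : (D.αG N a)⁻¹ ^ Nat.card (D.L₂ N) = 1 := by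
        rw [inv_pow, inv_eq_one]
        exact congrArg Subtype.val (pow_card_eq_one' (x := (⟨D.αG N a, a, rfl⟩ : D.L₂ N)))
      change D.counitHom ((N.ρ ^ Nat.card (D.L₂ N)) (D.of a)) = _
      rw [D.ρ_pow_apply N (D.ρ_of N a), ← Units.val_pow_eq_pow_val, h1]
      simp
    · intro i
      rw [D.algHom_x, D.algHom_x]
  exact DFunLike.congr_fun this h

/-- `L₂` has order `d` and consists of `d`-th roots of unity, of which a field has at most `d`. -/
theorem mem_L₂_of_pow_card_eq_one {ω : kˣ} (h : ω ^ Nat.card (D.L₂ N) = 1) : ω ∈ D.L₂ N := by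
  have : Finite (D.L₂ N) := (Set.finite_range (D.αG N)).to_subtype
  have : NeZero (Nat.card (D.L₂ N)) := ⟨Nat.card_pos.ne'⟩
  have hle : D.L₂ N ≤ rootsOfUnity (Nat.card (D.L₂ N)) k := fun y hy => by
    rw [mem_rootsOfUnity]
    exact congrArg Subtype.val (pow_card_eq_one' (x := (⟨y, hy⟩ : D.L₂ N)))
  rw [Subgroup.eq_of_le_of_card_ge hle (card_rootsOfUnity k _)]
  exact (mem_rootsOfUnity _ _).mpr h

/-- From `1 ∈ H_ω H_{ω⁻¹}` and multiplicativity, `ε(y) ≠ 0` for some `y ∈ H_ω`. Then `ε(y) =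
ε(ρ^d(y)) = ω^d ε(y)` gives `ω^d = 1`. -/
theorem L₁_eq_L₂_of_isStronglyGraded (h : IsStronglyGraded k (D.component N)) :
    D.L₁ N = D.L₂ N := by
  refine le_antisymm (fun ω hω => ?_) (D.L₂_le_L₁ N)
  have h1 : (1 : D.H) ∈ D.component N ⟨ω, hω⟩ * D.component N ⟨ω, hω⟩⁻¹ := by
    rw [h.2, mul_inv_cancel]
    simpa using D.algebraMap_mem_component_one N 1
  obtain ⟨y, hy, hy0⟩ : ∃ y ∈ D.component N ⟨ω, hω⟩, D.counitHom y ≠ 0 := by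
    by_contra! hcon
    have hle : D.component N ⟨ω, hω⟩ * D.component N ⟨ω, hω⟩⁻¹
        ≤ LinearMap.ker D.counitHom.toLinearMap := by
      rw [Submodule.mul_le]
      intro a ha b _
      simp [hcon a ha]
    have := hle h1
    simp at this
  apply D.mem_L₂_of_pow_card_eq_one N
  have h2 := D.counitHom_ρ_pow N y
  rw [D.ρ_pow_apply N ((D.mem_component N).mp hy), map_smul, smul_eq_mul] at h2
  exact Units.ext (by simpa using mul_right_cancel₀ hy0 (h2.trans (one_mul _).symm))

theorem exists_of_mem_component_of_eq (h : D.L₁ N = D.L₂ N) (ω : D.L₁ N) :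
    ∃ a : G, D.of a ∈ D.component N ω := by
  obtain ⟨a, ha⟩ : (ω : kˣ) ∈ D.L₂ N := h ▸ ω.2
  -- The inverse appears because `ρ` scales `g` by `α(g)⁻¹`.
  refine ⟨a⁻¹, ?_⟩
  have := D.of_mem_component N a⁻¹
  convert this using 2
  exact Subtype.ext (by simp [← ha])

/-! ### Crossed products -/

theorem isStronglyGraded_of_isCrossedProduct
    (h : IsCrossedProduct k (D.componentOne N) (D.component N)) :
    IsStronglyGraded k (D.component N) := by
  refine ⟨D.isDecomposition_component N, fun l l' => le_antisymm ?_ ?_⟩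
  · rw [Submodule.mul_le]
    exact fun a ha b hb => D.mul_mem_component N ha hb
  · obtain ⟨C, Φ, hmul, -, hmem⟩ := h
    -- The images of `H_1 ⊗ l` lie in the independent subspaces `H_l` and already span `H`, so each
    -- fills its `H_l`.
    have heq := ((D.iSupIndep_component N).le_iff_eq_of_iSup_eq_top (iSup_range_tmul_of Φ)).mp
      (by rintro l _ ⟨b, rfl⟩; exact hmem b l)
    intro y hy
    rw [← congrFun heq (l * l')] at hy
    obtain ⟨c, rfl⟩ := hy
    -- Cancelling the cocycle: `(c σ(l, l')⁻¹ ⊗ l) (1 ⊗ l') = c ⊗ l l'`.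
    have h1 := hmul (c * ((C.σ l l')⁻¹ : (D.componentOne N)ˣ)) 1 l l'
    rw [map_one, mul_one, Units.inv_mul_cancel_right] at h1
    change Φ (c ⊗ₜ _) ∈ _
    rw [← h1]
    exact Submodule.mul_mem_mul (hmem _ _) (hmem _ _)

theorem mem_componentOne {h : D.H} : h ∈ D.componentOne N ↔ h ∈ D.component N 1 := by
  rw [mem_component]
  simp [componentOne, AlgHom.mem_equalizer]

/-- Conjugation by a group element, on `H_1`. -/
def conj (a : G) : D.componentOne N →ₐ[k] D.componentOne N :=
  AlgHom.codRestrict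
    ((AlgHom.ofLinearMap (LinearMap.mulLeft k (D.of a) ∘ₗ LinearMap.mulRight k (D.of a⁻¹))
      (by simp [of_mul_of_inv])
      (fun b c => by
        simp only [LinearMap.comp_apply, LinearMap.mulLeft_apply, LinearMap.mulRight_apply]
        rw [show D.of a * (b * D.of a⁻¹) * (D.of a * (c * D.of a⁻¹))
          = D.of a * (b * (D.of a⁻¹ * D.of a) * c * D.of a⁻¹) by simp only [mul_assoc],
          of_inv_mul_of, mul_one])).comp (D.componentOne N).val)
    (D.componentOne N) (fun b => by
      have h1 := D.mul_mem_component N (D.of_mem_component N a)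
        (D.mul_mem_component N ((D.mem_componentOne N).mp b.2) (D.of_mem_component N a⁻¹))
      rw [mem_componentOne]
      rwa [show (⟨(D.αG N a)⁻¹, inv_mem (D.αG_mem_L₁ N a)⟩ : D.L₁ N)
        * (1 * ⟨(D.αG N a⁻¹)⁻¹, inv_mem (D.αG_mem_L₁ N a⁻¹)⟩) = 1 from
          Subtype.ext (by simp)] at h1)

theorem coe_conj (a : G) (b : D.componentOne N) :
    (D.conj N a b : D.H) = D.of a * (b * D.of a⁻¹) := rfl

/-- A group element lying in `H_1`, as a unit of `H_1`. -/
def unitOf (a : G) (ha : D.αG N a = 1) : (D.componentOne N)ˣ where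
  val := ⟨D.of a, by
    rw [mem_componentOne]; convert D.of_mem_component N a using 2; exact Subtype.ext (by simp [ha])⟩
  inv := ⟨D.of a⁻¹, by
    rw [mem_componentOne]; convert D.of_mem_component N a⁻¹ using 2
    exact Subtype.ext (by simp [ha])⟩
  val_inv := Subtype.ext (D.of_mul_of_inv a)
  inv_val := Subtype.ext (D.of_inv_mul_of a)

@[simp] theorem coe_unitOf (a : G) (ha : D.αG N a = 1) :
    ((D.unitOf N a ha : D.componentOne N) : D.H) = D.of a := rfl

theorem αG_eq_of_mem_component {a : G} {ω : D.L₁ N} (h : D.of a ∈ D.component N ω) :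
    D.αG N a = (ω : kˣ)⁻¹ := by
  rw [mem_component, ρ_of] at h
  have h1 : (((D.αG N a)⁻¹ : kˣ) : k) = ((ω : kˣ) : k) := smul_left_injective k (D.of_ne_zero a) h
  rw [← Units.ext h1, inv_inv]

/-- The crossed system defined by a choice of group elements in the components. -/
def crossedSystem (s : D.L₁ N → G) (hs : ∀ ω, D.of (s ω) ∈ D.component N ω) (hs1 : s 1 = 1) :
    CrossedSystem k (D.componentOne N) (D.L₁ N) where
  act ω := D.conj N (s ω)
  σ ω ω' := D.unitOf N (s ω * s ω' * (s (ω * ω'))⁻¹) (by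
    rw [map_mul, map_mul, map_inv, D.αG_eq_of_mem_component N (hs ω),
      D.αG_eq_of_mem_component N (hs ω'), D.αG_eq_of_mem_component N (hs (ω * ω')),
      ← mul_inv, Subgroup.coe_mul, mul_inv_cancel])
  act_one b := Subtype.ext (by simp [coe_conj, hs1])
  σ_one_left ω := Units.ext (Subtype.ext (by simp [hs1]))
  σ_one_right ω := Units.ext (Subtype.ext (by simp [hs1]))
  twisted ω ω' b := Subtype.ext (by
    simp only [MulMemClass.coe_mul, coe_conj, coe_unitOf]
    simp only [mul_assoc, ← map_mul]
    simp only [← mul_assoc, ← map_mul]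
    congr 2
    · congr 1
      simp [mul_assoc]
    · simp [mul_comm])
  cocycle ω ω' ω'' := Subtype.ext (by
    simp only [MulMemClass.coe_mul, coe_conj, coe_unitOf, ← map_mul]
    congr 1
    rw [mul_assoc ω]
    -- All terms are images of elements of the abelian group `G`, so the cocycle identity is one in
    -- `G`, here in additive notation.
    have key : ∀ {M : Type v} [AddCommGroup M] (a b c d e f : M),
        a + (b + c + -d + -a) + (a + d + -e) = a + b + -f + (f + c + -e) := by
      intros; abel
    exact key (M := Additive G) _ _ _ _ _ _)

theorem isCrossedProduct_of_forall_exists (h : ∀ ω : D.L₁ N, ∃ a : G, D.of a ∈ D.component N ω) :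
    IsCrossedProduct k (D.componentOne N) (D.component N) := by
  classical
  obtain ⟨s, hs, hs1⟩ : ∃ s : D.L₁ N → G, (∀ ω, D.of (s ω) ∈ D.component N ω) ∧ s 1 = 1 := by
    choose s hs using h
    -- The choice at `ω = 1` is reset to the identity so that `σ` is normalized and the isomorphism
    -- restricts to the inclusion on `H_1`.
    refine ⟨Function.update s 1 1, fun ω => ?_, by simp⟩
    by_cases hω : ω = 1
    · subst hω
      simpa using D.algebraMap_mem_component_one N 1
    · simpa [hω] using hs ω
  let U : MonoidAlgebra k (D.L₁ N) →ₗ[k] D.H :=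
    (MonoidAlgebra.basis (D.L₁ N) k).constr k fun ω => D.of (s ω)
  let Ψ : D.componentOne N ⊗[k] MonoidAlgebra k (D.L₁ N) →ₗ[k] D.H :=
    TensorProduct.lift ((LinearMap.mul k D.H).compl₁₂ (D.componentOne N).val.toLinearMap U)
  have hΨ : ∀ (b : D.componentOne N) (ω : D.L₁ N),
      Ψ (b ⊗ₜ MonoidAlgebra.of k _ ω) = b * D.of (s ω) := by
    intro b ω
    have hU : U (MonoidAlgebra.of k _ ω) = D.of (s ω) :=
      (MonoidAlgebra.basis (D.L₁ N) k).constr_basis k _ ω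
    simp [Ψ, -MonoidAlgebra.of_apply, hU]
  have hmem : ∀ (b : D.componentOne N) (ω : D.L₁ N),
      Ψ (b ⊗ₜ MonoidAlgebra.of k _ ω) ∈ D.component N ω := by
    intro b ω
    rw [hΨ]
    simpa using D.mul_mem_component N ((D.mem_componentOne N).mp b.2) (hs ω)
  have hinj : Function.Injective Ψ := by
    rw [injective_iff_map_eq_zero]
    intro w hw
    obtain ⟨b, rfl⟩ := (TensorProduct.equivFinsuppOfBasisRight (M := D.componentOne N)
      (MonoidAlgebra.basis (D.L₁ N) k)).symm.surjective w
    rw [TensorProduct.equivFinsuppOfBasisRight_symm_apply, Finsupp.sum, map_sum] at hw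
    -- The summands `b(ω) s(ω)` lie in different components, so each is zero, and the unit `s(ω)`
    -- cancels.
    have h0 := (iSupIndep_iff_finsetSum_eq_zero_imp_eq_zero _).mp (D.iSupIndep_component N)
      b.support _ (fun ω _ => hmem (b ω) ω) hw
    rw [TensorProduct.equivFinsuppOfBasisRight_symm_apply]
    refine Finset.sum_eq_zero fun ω hω => ?_
    have h1 := h0 ω hω
    rw [hΨ] at h1
    have h2 : b ω = 0 := Subtype.ext (by
      rw [← mul_one (b ω : D.H), ← D.of_mul_of_inv (s ω), ← mul_assoc, h1, zero_mul]; rfl)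
    change b ω ⊗ₜ _ = 0
    rw [h2, TensorProduct.zero_tmul]
  have hsurj : Function.Surjective Ψ := by
    rw [← LinearMap.range_eq_top, eq_top_iff, ← D.iSup_component N, iSup_le_iff]
    intro ω y hy
    -- `y = (y s(ω)⁻¹) s(ω)`, and the first factor has degree `ω ω⁻¹ = 1`.
    have hb : y * D.of (s ω)⁻¹ ∈ D.componentOne N := by
      rw [mem_componentOne]
      convert D.mul_mem_component N hy (D.of_mem_component N (s ω)⁻¹) using 2
      exact Subtype.ext (by simp [D.αG_eq_of_mem_component N (hs ω)])
    refine ⟨⟨_, hb⟩ ⊗ₜ MonoidAlgebra.of k _ ω, ?_⟩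
    rw [hΨ, mul_assoc, of_inv_mul_of, mul_one]
  refine ⟨D.crossedSystem N s hs hs1, LinearEquiv.ofBijective Ψ ⟨hinj, hsurj⟩, ?_, ?_, hmem⟩
  · intro b b' ω ω'
    change Ψ _ * Ψ _ = Ψ _
    rw [hΨ, hΨ, hΨ]
    simp only [crossedSystem, MulMemClass.coe_mul, coe_conj, coe_unitOf]
    simp only [mul_assoc, ← map_mul]
    congr 4
    simp [mul_comm]
  · intro b
    have := hΨ b 1
    rw [map_one, hs1, map_one, mul_one] at this
    exact this

end Datum
end QLS

end

theorem mainTheorem1 {k : Type*} [Field k] {G : Type*} [CommGroup G] [Finite G] {n : ℕ}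
    (D : QLS.Datum k G n) :
    Nonempty (QLS.NakayamaData k D.H) ∧
    ∀ N : QLS.NakayamaData k D.H,
      QLS.IsDecomposition k (D.component N) ∧
      List.TFAE [
        QLS.IsStronglyGraded k (D.component N),
        ∀ ω : D.L₁ N, ∃ a : G, D.of a ∈ D.component N ω,
        D.L₁ N = D.L₂ N,
        QLS.IsCrossedProduct k (D.componentOne N) (D.component N)] := by
  refine ⟨D.nonempty_nakayamaData, fun N => ⟨D.isDecomposition_component N, ?_⟩⟩
  tfae_have 1 → 3 := D.L₁_eq_L₂_of_isStronglyGraded N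
  tfae_have 3 → 2 := D.exists_of_mem_component_of_eq N
  tfae_have 2 → 4 := D.isCrossedProduct_of_forall_exists N
  tfae_have 4 → 1 := D.isStronglyGraded_of_isCrossedProduct N
  tfae_finish
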